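/- Let $n\ge 0$ and $\mathcal H_n=L^2(\mathbb R^n)$, with position operators $\hat x_j$ (multiplication by the $j$-th coordinate) and momentum operators $\hat p_j=-i\,\partial/\partial q_j$, and identify $\mathcal H_n\otimes\mathcal H_n$ with $L^2(\mathbb R^n\times\mathbb R^n)$. For $\theta\in\mathbb R$ let $U_\theta$ be the unitary on $L^2(\mathbb R^n\times\mathbb R^n)$ given by $$(U_\theta\psi)(x,y)=\psi(\cos\theta\,x+\sin\theta\,y,\,-\sin\theta\,x+\cos\theta\,y).$$ A state is a positive trace-class operator of trace $1$, and a state on $\mathcal H_n\otimes\mathcal H_n$ is a product state if it equals $\sigma_1\otimes\sigma_2$ for some states $\sigma_1,\sigma_2$ on $\mathcal H_n$. With $R=(\hat x_1,\dots,\hat x_n,\hat p_1,\dots,\hat p_n)$ and $\Omega=\begin{pmatrix}0&1\\-1&0\end{pmatrix}$, the displacement operators are $D_r=\exp(i\,r^{\mathsf T}\Omega R)$ for $r\in\mathbb R^{2n}$, and a state $\rho$ on $\mathcal H_n$ is Gaussian if its characteristic function $\chi_\rho(r)=\operatorname{Tr}[D_r\rho]$ has the form $$\chi_\rho(r)=\exp\!\Big(-\tfrac14(\Omega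 r)^{\mathsf T}V(\Omega r)+i\,r^{\mathsf T}\Omega m\Big)\qquad(r\in\mathbb R^{2n})$$ for some real symmetric positive semidefinite matrix $V$ and some (arbitrary) $m\in\mathbb R^{2n}$. **Theorem.** Let $\rho$ be a state on $\mathcal H_n$ with finite second moments, i.e. $\operatorname{Tr}[\hat x_j^2\rho]<\infty$ and $\operatorname{Tr}[\hat p_j^2\rho]<\infty$ for all $j$. Then the following are equivalent: 1. $U_\theta(\rho\otimes\rho)U_\theta^\dagger$ is a product state for all $\theta\in[0,2\pi]$; 2. $U_\theta(\rho\otimes\rho)U_\theta^\dagger$ is a product state for some $\theta\in\mathbb R$ which is not an integer multiple of $\pi/2$; 3. $\rho$ is a Gaussian state. -/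

import Mathlib

open MeasureTheory
open scoped ENNReal FourierTransform TensorProduct

namespace QuantumGaussian

noncomputable section

/-! ### Traces and density operators -/

/-- `A` is trace class with trace `t`: in every orthonormal basis the diagonal matrix elements of
`A` sum (unconditionally) to `t`. -/
def HasTrace {H : Type*} [NormedAddCommGroup H] [InnerProductSpace ℂ H] [CompleteSpace H]
    (A : H →L[ℂ] H) (t : ℂ) : Prop :=
  ∀ (s : Set H) (b : HilbertBasis s ℂ H), HasSum (fun i => inner ℂ (b i) (A (b i))) t

/-- The index set of some orthonormal basis of `H`. -/
def basisSet (H : Type*) [NormedAddCommGroup H] [InnerProductSpace ℂ H] [CompleteSpace H] :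
    Set H :=
  (exists_hilbertBasis ℂ H).choose

/-- Some orthonormal basis of `H`. -/
def basis (H : Type*) [NormedAddCommGroup H] [InnerProductSpace ℂ H] [CompleteSpace H] :
    HilbertBasis (basisSet H) ℂ H :=
  (exists_hilbertBasis ℂ H).choose_spec.choose

/-- The trace of a trace class operator, computed in some orthonormal basis. -/
def opTrace {H : Type*} [NormedAddCommGroup H] [InnerProductSpace ℂ H] [CompleteSpace H]
    (A : H →L[ℂ] H) : ℂ :=
  ∑' i, inner ℂ (basis H i) (A (basis H i))

theorem HasTrace.opTrace_eq {H : Type*} [NormedAddCommGroup H] [InnerProductSpace ℂ H]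
    [CompleteSpace H] {A : H →L[ℂ] H} {t : ℂ} (h : HasTrace A t) : opTrace A = t :=
  (h _ (basis H)).tsum_eq

/-- A state (density operator): a positive trace class operator of trace one. -/
structure IsDensityOperator {H : Type*} [NormedAddCommGroup H] [InnerProductSpace ℂ H]
    [CompleteSpace H] (ρ : H →L[ℂ] H) : Prop where
  isPositive : ρ.IsPositive
  hasTrace_one : HasTrace ρ 1

/-- The positive square root `√ρ` of a positive operator. -/
def opSqrt {H : Type*} [NormedAddCommGroup H] [InnerProductSpace ℂ H] [CompleteSpace H]
    (ρ : H →L[ℂ] H) : H →L[ℂ] H :=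
  CFC.sqrt ρ

/-! ### The Hilbert space of `n` modes and of two copies of it -/

/-- The configuration space `ℝⁿ`. -/
abbrev Conf (n : ℕ) : Type := EuclideanSpace ℝ (Fin n)

/-- The Hilbert space `L²(ℝⁿ)` of `n` modes. -/
abbrev Modes (n : ℕ) : Type := Lp ℂ 2 (volume : Measure (Conf n))

/-- Two copies of the `n`-mode Hilbert space, `L²(ℝⁿ) ⊗ L²(ℝⁿ) = L²(ℝⁿ × ℝⁿ)`. -/
abbrev TwoModes (n : ℕ) : Type := Lp ℂ 2 (volume : Measure (Conf n × Conf n))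

theorem memLp_tensor {n : ℕ} (f g : Modes n) :
    MemLp (fun z : Conf n × Conf n => f z.1 * g z.2) 2 volume := by
  have hf := Lp.memLp f
  have hg := Lp.memLp g
  have hm : AEStronglyMeasurable (fun z : Conf n × Conf n => f z.1 * g z.2)
      (volume : Measure (Conf n × Conf n)) :=
    (hf.1.comp_fst (ν := volume)).mul (hg.1.comp_snd (μ := volume))
  rw [memLp_two_iff_integrable_sq_norm hm]
  have h := ((memLp_two_iff_integrable_sq_norm hf.1).1 hf).mul_prod
    ((memLp_two_iff_integrable_sq_norm hg.1).1 hg)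
  refine h.congr (Filter.Eventually.of_forall fun z => ?_)
  simp [mul_pow]

/-- The vector `f ⊗ g`, i.e. the function `(x, y) ↦ f x * g y`. -/
def tensorVec {n : ℕ} (f g : Modes n) : TwoModes n := (memLp_tensor f g).toLp _

theorem coeFn_tensorVec {n : ℕ} (f g : Modes n) :
    tensorVec f g =ᵐ[volume] fun z : Conf n × Conf n => f z.1 * g z.2 :=
  (memLp_tensor f g).coeFn_toLp

theorem ae_fst {n : ℕ} {P : Conf n → Prop} (h : ∀ᵐ x, P x) :
    ∀ᵐ z : Conf n × Conf n, P z.1 :=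
  Measure.quasiMeasurePreserving_fst.ae h

theorem ae_snd {n : ℕ} {P : Conf n → Prop} (h : ∀ᵐ x, P x) :
    ∀ᵐ z : Conf n × Conf n, P z.2 :=
  Measure.quasiMeasurePreserving_snd.ae h

theorem tensorVec_add_left {n : ℕ} (f f' g : Modes n) :
    tensorVec (f + f') g = tensorVec f g + tensorVec f' g := by
  apply Lp.ext
  filter_upwards [coeFn_tensorVec (f + f') g, coeFn_tensorVec f g, coeFn_tensorVec f' g,
    Lp.coeFn_add (tensorVec f g) (tensorVec f' g), ae_fst (Lp.coeFn_add f f')]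
    with z h1 h2 h3 h4 h5
  rw [h1, h4, Pi.add_apply, h2, h3, h5, Pi.add_apply, add_mul]

theorem tensorVec_add_right {n : ℕ} (f g g' : Modes n) :
    tensorVec f (g + g') = tensorVec f g + tensorVec f g' := by
  apply Lp.ext
  filter_upwards [coeFn_tensorVec f (g + g'), coeFn_tensorVec f g, coeFn_tensorVec f g',
    Lp.coeFn_add (tensorVec f g) (tensorVec f g'), ae_snd (Lp.coeFn_add g g')]
    with z h1 h2 h3 h4 h5
  rw [h1, h4, Pi.add_apply, h2, h3, h5, Pi.add_apply, mul_add]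

theorem tensorVec_smul_left {n : ℕ} (c : ℂ) (f g : Modes n) :
    tensorVec (c • f) g = c • tensorVec f g := by
  apply Lp.ext
  filter_upwards [coeFn_tensorVec (c • f) g, coeFn_tensorVec f g,
    Lp.coeFn_smul c (tensorVec f g), ae_fst (Lp.coeFn_smul c f)] with z h1 h2 h3 h4
  rw [h1, h3, Pi.smul_apply, h2, h4, Pi.smul_apply, smul_eq_mul, smul_eq_mul, mul_assoc]

theorem tensorVec_smul_right {n : ℕ} (c : ℂ) (f g : Modes n) :
    tensorVec f (c • g) = c • tensorVec f g := by
  apply Lp.ext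
  filter_upwards [coeFn_tensorVec f (c • g), coeFn_tensorVec f g,
    Lp.coeFn_smul c (tensorVec f g), ae_snd (Lp.coeFn_smul c g)] with z h1 h2 h3 h4
  rw [h1, h3, Pi.smul_apply, h2, h4, Pi.smul_apply, smul_eq_mul, smul_eq_mul]
  ring

/-- The canonical map from the algebraic tensor product `L²(ℝⁿ) ⊗ L²(ℝⁿ)` to `L²(ℝⁿ × ℝⁿ)`,
sending `f ⊗ₜ g` to `(x, y) ↦ f x * g y`. -/
def tensorMap (n : ℕ) : (Modes n ⊗[ℂ] Modes n) →ₗ[ℂ] TwoModes n :=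
  TensorProduct.lift (LinearMap.mk₂ ℂ tensorVec tensorVec_add_left tensorVec_smul_left
    tensorVec_add_right tensorVec_smul_right)

theorem tensorMap_tmul {n : ℕ} (f g : Modes n) : tensorMap n (f ⊗ₜ g) = tensorVec f g := rfl

theorem inner_tensorVec {n : ℕ} (f g f' g' : Modes n) :
    inner ℂ (tensorVec f g) (tensorVec f' g') = inner ℂ f f' * inner ℂ g g' := by
  rw [L2.inner_def, L2.inner_def, L2.inner_def, ← integral_prod_mul]
  refine integral_congr_ae ?_
  filter_upwards [coeFn_tensorVec f g, coeFn_tensorVec f' g'] with z h1 h2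
  rw [h1, h2]
  simp only [RCLike.inner_apply, map_mul]
  ring

theorem inner_tensorMap {n : ℕ} (u v : Modes n ⊗[ℂ] Modes n) :
    inner ℂ (tensorMap n u) (tensorMap n v) = inner ℂ u v := by
  induction u with
  | zero => simp
  | add a b ha hb => rw [map_add, inner_add_left, inner_add_left, ha, hb]
  | tmul f g =>
    induction v with
    | zero => simp
    | add a b ha hb => rw [map_add, inner_add_right, inner_add_right, ha, hb]
    | tmul f' g' =>
      rw [tensorMap_tmul, tensorMap_tmul, inner_tensorVec, TensorProduct.inner_tmul]

theorem norm_tensorMap {n : ℕ} (u : Modes n ⊗[ℂ] Modes n) : ‖tensorMap n u‖ = ‖u‖ := by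
  rw [@norm_eq_sqrt_re_inner ℂ, @norm_eq_sqrt_re_inner ℂ, inner_tensorMap]

theorem setIntegral_rect {n : ℕ} (F : TwoModes n)
    (hF : ∀ f g : Modes n, inner ℂ (tensorVec f g) F = 0) {s t : Set (Conf n)}
    (hs : MeasurableSet s) (ht : MeasurableSet t) (hs' : volume s ≠ ∞) (ht' : volume t ≠ ∞) :
    ∫ z in s ×ˢ t, F z = 0 := by
  have h := hF (indicatorConstLp 2 hs hs' 1) (indicatorConstLp 2 ht ht' 1)
  rw [L2.inner_def] at h
  rw [← h, ← integral_indicator (hs.prod ht)]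
  refine integral_congr_ae ?_
  filter_upwards [coeFn_tensorVec (indicatorConstLp 2 hs hs' (1 : ℂ))
    (indicatorConstLp 2 ht ht' (1 : ℂ)),
    ae_fst (indicatorConstLp_coeFn (p := 2) (hs := hs) (hμs := hs') (c := (1 : ℂ))),
    ae_snd (indicatorConstLp_coeFn (p := 2) (hs := ht) (hμs := ht') (c := (1 : ℂ)))]
    with z h1 h2 h3
  rw [h1, h2, h3]
  by_cases ha : z.1 ∈ s <;> by_cases hb : z.2 ∈ t <;> simp [Set.indicator, ha, hb]

theorem eq_zero_of_inner_tensorVec {n : ℕ} (F : TwoModes n)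
    (hF : ∀ f g : Modes n, inner ℂ (tensorVec f g) F = 0) : F = 0 := by
  have key : ∀ k : ℕ, ∀ᵐ z : Conf n × Conf n,
      z ∈ Metric.ball (0 : Conf n) k ×ˢ Metric.ball (0 : Conf n) k → F z = 0 := by
    intro k
    set B : Set (Conf n) := Metric.ball 0 k with hB
    have hBm : MeasurableSet B := Metric.isOpen_ball.measurableSet
    have hBf : volume B ≠ ∞ := measure_ball_lt_top.ne
    have hfin : volume (B ×ˢ B) < ∞ := by
      rw [Measure.volume_eq_prod, Measure.prod_prod]
      exact ENNReal.mul_lt_top hBf.lt_top hBf.lt_top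
    have : Fact (volume (B ×ˢ B) < ∞) := ⟨hfin⟩
    have hint : IntegrableOn F (B ×ˢ B) :=
      ((Lp.memLp F).restrict (B ×ˢ B)).integrable (by norm_num)
    rw [← ae_restrict_iff' (hBm.prod hBm)]
    refine Integrable.ae_eq_zero_of_forall_setIntegral_eq_zero (f := F) hint ?_
    intro s hs hs'
    clear hs'
    rw [Measure.restrict_restrict hs]
    induction s, hs using MeasurableSpace.induction_on_inter
      (generateFrom_prod (α := Conf n) (β := Conf n)).symm isPiSystem_prod with
    | empty => simp
    | basic t ht =>
      obtain ⟨a, ha, b, hb, rfl⟩ := ht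
      rw [Set.prod_inter_prod]
      exact setIntegral_rect F hF (MeasurableSet.inter (show MeasurableSet a from ha) hBm)
        (MeasurableSet.inter (show MeasurableSet b from hb) hBm)
        (measure_ne_top_of_subset Set.inter_subset_right hBf)
        (measure_ne_top_of_subset Set.inter_subset_right hBf)
    | compl t ht ih =>
      have h1 := integral_inter_add_sdiff (s := B ×ˢ B) ht hint
      rw [Set.inter_comm, ih, zero_add, setIntegral_rect F hF hBm hBm hBf hBf] at h1
      rwa [Set.inter_comm, ← Set.sdiff_eq]
    | iUnion f hd hm ih =>
      rw [Set.iUnion_inter, integral_iUnion (fun i => (hm i).inter (hBm.prod hBm))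
        (fun i j hij => (hd hij).mono Set.inter_subset_left Set.inter_subset_left)
        (hint.mono_set (Set.iUnion_subset fun i => Set.inter_subset_right))]
      simp [ih]
  apply Lp.ext
  filter_upwards [ae_all_iff.2 key, Lp.coeFn_zero ℂ 2 (volume : Measure (Conf n × Conf n))]
    with z hz h0
  obtain ⟨k, hk⟩ := exists_nat_gt (max ‖z.1‖ ‖z.2‖)
  rw [h0, hz k ⟨by simpa using (le_max_left _ _).trans_lt hk,
    by simpa using (le_max_right _ _).trans_lt hk⟩]
  rfl

theorem denseRange_tensorMap (n : ℕ) : DenseRange (tensorMap n) := by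
  have h : (LinearMap.range (tensorMap n)).topologicalClosure = ⊤ := by
    rw [Submodule.topologicalClosure_eq_top_iff, Submodule.eq_bot_iff]
    intro F hF
    refine eq_zero_of_inner_tensorVec F fun f g => ?_
    exact (Submodule.mem_orthogonal _ F).1 hF _ ⟨f ⊗ₜ g, rfl⟩
  have h2 := (Submodule.dense_iff_topologicalClosure_eq_top).2 h
  rwa [LinearMap.coe_range] at h2

/-- The tensor product `A ⊗ B` of bounded operators as an operator on `L²(ℝⁿ × ℝⁿ)`: the
continuous extension of `f ⊗ g ↦ A f ⊗ B g`. -/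
def tensorOp {n : ℕ} (A B : Modes n →L[ℂ] Modes n) : TwoModes n →L[ℂ] TwoModes n :=
  LinearMap.extendOfNorm (tensorMap n ∘ₗ (TensorProduct.mapL A B).toLinearMap) (tensorMap n)

theorem tensorOp_tensorVec {n : ℕ} (A B : Modes n →L[ℂ] Modes n) (f g : Modes n) :
    tensorOp A B (tensorVec f g) = tensorVec (A f) (B g) := by
  rw [← tensorMap_tmul, tensorOp, LinearMap.extendOfNorm_eq (denseRange_tensorMap n)]
  · rfl
  · refine ⟨‖TensorProduct.mapL A B‖, fun x => ?_⟩
    rw [norm_tensorMap]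
    exact (norm_tensorMap _).trans_le ((TensorProduct.mapL A B).le_opNorm x)

/-- A state of two copies is a product state if it is `σ₁ ⊗ σ₂` for states `σ₁`, `σ₂`. -/
def IsProductState {n : ℕ} (T : TwoModes n →L[ℂ] TwoModes n) : Prop :=
  ∃ σ₁ σ₂ : Modes n →L[ℂ] Modes n,
    IsDensityOperator σ₁ ∧ IsDensityOperator σ₂ ∧ T = tensorOp σ₁ σ₂

/-! ### Rotations between the two copies -/

/-- `(x, y) ↦ (cos θ x + sin θ y, -sin θ x + cos θ y)`. -/
def rot {n : ℕ} (θ : ℝ) (z : Conf n × Conf n) : Conf n × Conf n :=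
  (Real.cos θ • z.1 + Real.sin θ • z.2, -(Real.sin θ • z.1) + Real.cos θ • z.2)

theorem rot_rot_neg {n : ℕ} (θ : ℝ) (z : Conf n × Conf n) : rot θ (rot (-θ) z) = z := by
  have h := Real.sin_sq_add_cos_sq θ
  ext i
  · simp [rot]
    linear_combination (z.1 i) * h
  · simp [rot]
    linear_combination (z.2 i) * h

theorem norm_sq_rot {n : ℕ} (θ : ℝ) (z : Conf n × Conf n) :
    ‖(rot θ z).1‖ ^ 2 + ‖(rot θ z).2‖ ^ 2 = ‖z.1‖ ^ 2 + ‖z.2‖ ^ 2 := by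
  have h := Real.sin_sq_add_cos_sq θ
  simp only [EuclideanSpace.real_norm_sq_eq, ← Finset.sum_add_distrib]
  refine Finset.sum_congr rfl fun i _ => ?_
  simp [rot]
  linear_combination (z.1 i ^ 2 + z.2 i ^ 2) * h

/-- The rotation as a linear isometry of `ℝⁿ × ℝⁿ` with its Euclidean norm. -/
def rotIsometry (n : ℕ) (θ : ℝ) :
    WithLp 2 (Conf n × Conf n) ≃ₗᵢ[ℝ] WithLp 2 (Conf n × Conf n) where
  toFun z := WithLp.toLp 2 (rot θ z.ofLp)
  invFun z := WithLp.toLp 2 (rot (-θ) z.ofLp)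
  map_add' z w := by
    apply (WithLp.ofLp_injective 2)
    ext i <;> simp [rot] <;> ring
  map_smul' c z := by
    apply (WithLp.ofLp_injective 2)
    ext i <;> simp [rot] <;> ring
  left_inv z := by
    have h := rot_rot_neg (-θ) z.ofLp
    rw [neg_neg] at h
    simp [h]
  right_inv z := by simp [rot_rot_neg]
  norm_map' z := by
    rw [← sq_eq_sq₀ (norm_nonneg _) (norm_nonneg _), WithLp.prod_norm_sq_eq_of_L2,
      WithLp.prod_norm_sq_eq_of_L2]
    exact norm_sq_rot θ z.ofLp

theorem measurePreserving_rot {n : ℕ} (θ : ℝ) :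
    MeasurePreserving (rot θ : Conf n × Conf n → Conf n × Conf n) volume volume :=
  (WithLp.volume_preserving_ofLp (Conf n) (Conf n)).comp
    ((rotIsometry n θ).measurePreserving.comp (WithLp.volume_preserving_toLp (Conf n) (Conf n)))

/-- The unitary `(U_θ ψ)(x, y) = ψ(cos θ x + sin θ y, -sin θ x + cos θ y)` on `L²(ℝⁿ × ℝⁿ)`. -/
def rotU (n : ℕ) (θ : ℝ) : TwoModes n →L[ℂ] TwoModes n :=
  (Lp.compMeasurePreservingₗᵢ ℂ (rot θ) (measurePreserving_rot θ)).toContinuousLinearMap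

/-- `U_θ T U_θ†`. -/
def rotConj {n : ℕ} (θ : ℝ) (T : TwoModes n →L[ℂ] TwoModes n) : TwoModes n →L[ℂ] TwoModes n :=
  rotU n θ ∘L T ∘L ContinuousLinearMap.adjoint (rotU n θ)

/-! ### Phase space, displacement operators and characteristic functions -/

/-- Phase space `ℝ²ⁿ`, with points `r = (x₁, …, xₙ, p₁, …, pₙ)`. -/
abbrev Phase (n : ℕ) : Type := Fin n ⊕ Fin n → ℝ

/-- The position part `x` of `r = (x, p)`. -/
def posPart {n : ℕ} (r : Phase n) : Conf n := WithLp.toLp 2 fun j => r (Sum.inl j)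

/-- The momentum part `p` of `r = (x, p)`. -/
def momPart {n : ℕ} (r : Phase n) : Conf n := WithLp.toLp 2 fun j => r (Sum.inr j)

/-- The symplectic form `Ω = (0, 1; -1, 0)`. -/
def Omega (n : ℕ) : Matrix (Fin n ⊕ Fin n) (Fin n ⊕ Fin n) ℝ := Matrix.fromBlocks 0 1 (-1) 0

/-- Multiplication by a measurable function of modulus one, as an isometry of `L²(ℝⁿ)`. -/
def phaseMul {n : ℕ} (c : Conf n → ℂ) (hc : Measurable c) (h1 : ∀ q, ‖c q‖ = 1) :
    Modes n →ₗᵢ[ℂ] Modes n :=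
  have hmem : ∀ f : Modes n, MemLp (fun q => c q * f q) 2 volume := fun f =>
    (Lp.memLp f).of_le (hc.aestronglyMeasurable.mul (Lp.aestronglyMeasurable f))
      (Filter.Eventually.of_forall fun q => by simp [h1])
  { toFun := fun f => (hmem f).toLp _
    map_add' := fun f g => by
      rw [← MemLp.toLp_add]
      refine MemLp.toLp_congr _ _ ?_
      filter_upwards [Lp.coeFn_add f g] with q hq
      rw [Pi.add_apply, hq, Pi.add_apply, mul_add]
    map_smul' := fun a f => by
      rw [RingHom.id_apply, ← MemLp.toLp_const_smul]
      refine MemLp.toLp_congr _ _ ?_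
      filter_upwards [Lp.coeFn_smul a f] with q hq
      rw [Pi.smul_apply, hq, Pi.smul_apply, smul_eq_mul, smul_eq_mul, mul_left_comm]
    norm_map' := fun f => by
      change ‖(hmem f).toLp _‖ = _
      rw [Lp.norm_toLp, Lp.norm_def]
      congr 1
      exact eLpNorm_congr_norm_ae (Filter.Eventually.of_forall fun q => by simp [h1]) }

/-- Translation `(T ψ)(q) = ψ(q + x)` on `L²(ℝⁿ)`. -/
def translation {n : ℕ} (x : Conf n) : Modes n →ₗᵢ[ℂ] Modes n :=
  Lp.compMeasurePreservingₗᵢ ℂ (fun q => q + x) (measurePreserving_add_right volume x)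

/-- The displacement operator `D_r = exp(i rᵀ Ω R) = exp(i (x ⬝ p̂ - p ⬝ x̂))` for `r = (x, p)`
and the quadratures `R = (x̂, p̂)`, where `x̂ⱼ` is multiplication by `qⱼ` and `p̂ⱼ = -i ∂/∂qⱼ`.
Explicitly, `(D_r ψ)(q) = exp(-i (p ⬝ q + p ⬝ x / 2)) ψ(q + x)`. -/
def displacement {n : ℕ} (r : Phase n) : Modes n →L[ℂ] Modes n :=
  ((phaseMul
    (fun q => Complex.exp (((-(inner ℝ (momPart r) q + inner ℝ (momPart r) (posPart r) / 2) : ℝ) : ℂ)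
      * Complex.I))
    (by fun_prop) (fun q => Complex.norm_exp_ofReal_mul_I _)).comp
    (translation (posPart r))).toContinuousLinearMap

/-- The characteristic function `χ_ρ(r) = Tr[D_r ρ]`. -/
def charFn {n : ℕ} (ρ : Modes n →L[ℂ] Modes n) (r : Phase n) : ℂ :=
  opTrace (displacement r ∘L ρ)

open Matrix in
/-- A state is Gaussian if its characteristic function is Gaussian,
`χ_ρ(r) = exp(-(1/4) (Ω r)ᵀ V (Ω r) + i rᵀ Ω m)`
for some mean vector `m` and some (real symmetric, nonnegative) matrix `V`. -/
def IsGaussian {n : ℕ} (ρ : Modes n →L[ℂ] Modes n) : Prop :=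
  ∃ (V : Matrix (Fin n ⊕ Fin n) (Fin n ⊕ Fin n) ℝ) (m : Phase n), V.PosSemidef ∧
    ∀ r : Phase n, charFn ρ r =
      Complex.exp (((-(1 / 4) * ((Omega n *ᵥ r) ⬝ᵥ (V *ᵥ (Omega n *ᵥ r))) : ℝ) : ℂ)
        + ((r ⬝ᵥ (Omega n *ᵥ m) : ℝ) : ℂ) * Complex.I)

/-! ### Second moments -/

/-- `‖x̂ⱼ ψ‖²`, with value `∞` if `ψ` is not in the domain of the position operator `x̂ⱼ`. -/
def positionSq {n : ℕ} (j : Fin n) (ψ : Modes n) : ℝ≥0∞ :=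
  ∫⁻ q, ENNReal.ofReal (q j ^ 2) * ‖ψ q‖ₑ ^ 2

/-- `‖p̂ⱼ ψ‖²`, with value `∞` if `ψ` is not in the domain of the momentum operator
`p̂ⱼ = -i ∂/∂qⱼ`, which is multiplication by `2 π kⱼ` after the Fourier transform
`∫ exp(-2 π i k ⬝ q) ψ(q) dq`. -/
def momentumSq {n : ℕ} (j : Fin n) (ψ : Modes n) : ℝ≥0∞ :=
  ∫⁻ k, ENNReal.ofReal ((2 * Real.pi * k j) ^ 2) * ‖(𝓕 ψ : Modes n) k‖ₑ ^ 2

/-- `Tr[Q² ρ] = Tr[√ρ Q² √ρ] = ∑ᵢ ‖Q √ρ eᵢ‖²` for a self-adjoint operator `Q`, given through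
`qSq ψ = ‖Q ψ‖²`, and an orthonormal basis `(eᵢ)`. -/
def secondMoment {n : ℕ} (qSq : Modes n → ℝ≥0∞) (ρ : Modes n →L[ℂ] Modes n) : ℝ≥0∞ :=
  ∑' i, qSq (opSqrt ρ (basis (Modes n) i))

/-- All second moments `Tr[x̂ⱼ² ρ]` and `Tr[p̂ⱼ² ρ]` are finite. -/
def HasFiniteSecondMoments {n : ℕ} (ρ : Modes n →L[ℂ] Modes n) : Prop :=
  ∀ j : Fin n, secondMoment (positionSq j) ρ < ∞ ∧ secondMoment (momentumSq j) ρ < ∞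

end

end QuantumGaussian

/-! Characteristic functions turn the statement into a functional equation of Kac–Bernstein type.
Displacement operators of two copies are carried through `rotU` to displacements with rotated
arguments (`twoDisplacement_rotU`). With `c = cos θ` and `s = sin θ`, a product output therefore
gives `χ(c r + s t) χ(-s r + c t) = A r * B t`, where `χ` is the characteristic function of `ρ` and
`A`, `B` are those of the two factors.

If `c` and `s` are nonzero, this equation forces a Gaussian. A contraction argument shows that `χ`
has no zeros (`ne_zero_of_rotation_eq`). Eliminating `A` and `B` gives the multiplicative form of
the quadratic functional equation (`quadratic_of_rotation_eq`). Its modulus makes `log ‖χ‖` a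
quadratic form, with sign fixed by `‖χ‖ ≤ 1`; its phase is a continuous character, hence the
exponential of a linear form (`exists_gaussian_of_rotation_eq`).

Conversely, for Gaussian `χ` the quadratic exponent is invariant under the rotation, and only the
mean changes. Both factors can be taken to be displaced copies of `ρ`, so no existence theorem for
Gaussian states is needed. Equality of operators follows from equality of characteristic functions
by `IsEnsemble.eq_of_opTrace_twoDisplacement`: after a shear of variables and Fourier inversion for
Schwartz functions, matrix elements are integrals of the characteristic function.

Trace class operators are handled throughout as mixtures `∑ᵢ |gᵢ⟩⟨gᵢ|`, which reduces identities for
traces to identities for single vectors. -/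

namespace QuantumGaussian

noncomputable section

/-! ### Positive trace class operators as mixtures of vectors. -/

section Ensemble

universe u

variable {H : Type u} [NormedAddCommGroup H] [InnerProductSpace ℂ H]

/-- The positive operator `T` is the mixture `∑ᵢ |gᵢ⟩⟨gᵢ|` with `∑ᵢ ‖gᵢ‖² < ∞`. -/
structure IsEnsemble {ι : Type*} (g : ι → H) (T : H →L[ℂ] H) : Prop where
  summable : Summable fun i => ‖g i‖ ^ 2
  hasSum : ∀ φ ψ : H, HasSum (fun i => inner ℂ φ (g i) * inner ℂ (g i) ψ) (inner ℂ φ (T ψ))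

theorem norm_inner_apply_le (A : H →L[ℂ] H) (g : H) : ‖inner ℂ g (A g)‖ ≤ ‖A‖ * ‖g‖ ^ 2 := by
  refine (norm_inner_le_norm _ _).trans ?_
  nlinarith [A.le_opNorm g, norm_nonneg g]

theorem IsEnsemble.summable_inner {ι : Type*} {g : ι → H} {T : H →L[ℂ] H} (h : IsEnsemble g T)
    (A : H →L[ℂ] H) : Summable fun i => inner ℂ (g i) (A (g i)) :=
  .of_norm_bounded (h.summable.mul_left ‖A‖) fun i => norm_inner_apply_le A (g i)

/-- The rank-one operators have norm `‖g i‖ ^ 2`, so their sum converges absolutely in operator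
norm. -/
theorem exists_isEnsemble [CompleteSpace H] {ι : Type*} (g : ι → H)
    (h : Summable fun i => ‖g i‖ ^ 2) : ∃ T : H →L[ℂ] H, IsEnsemble g T := by
  have hs : Summable fun i => InnerProductSpace.rankOne ℂ (g i) (g i) :=
    .of_norm_bounded h fun i => by rw [InnerProductSpace.norm_rankOne, sq]
  refine ⟨∑' i, InnerProductSpace.rankOne ℂ (g i) (g i), h, fun φ ψ => ?_⟩
  have h1 := hs.hasSum.mapL (ContinuousLinearMap.apply ℂ H ψ)
  have h2 := h1.mapL (innerSL ℂ φ)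
  simpa [inner_smul_right, mul_comm] using h2

theorem hasSum_norm_inner_sq {κ : Type*} (b : HilbertBasis κ ℂ H) (x : H) :
    HasSum (fun k => ‖inner ℂ (b k) x‖ ^ 2) (‖x‖ ^ 2) := by
  have h := b.hasSum_inner_mul_inner x x
  have h1 : ∀ k, inner ℂ x (b k) * inner ℂ (b k) x = ((‖inner ℂ (b k) x‖ ^ 2 : ℝ) : ℂ) :=
    fun k => by
      rw [← inner_conj_symm x (b k), Complex.conj_mul']
      push_cast
      rfl
  have h2 : inner ℂ x x = ((‖x‖ ^ 2 : ℝ) : ℂ) := by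
    rw [inner_self_eq_norm_sq_to_K]
    push_cast
    rfl
  simp only [h1, h2] at h
  exact Complex.hasSum_ofReal.1 h

/-- `Tr[A T] = ∑ᵢ ⟨gᵢ, A gᵢ⟩`. -/
theorem IsEnsemble.hasSum_trace [CompleteSpace H] {ι κ : Type*} {g : ι → H} {T : H →L[ℂ] H}
    (h : IsEnsemble g T) (A : H →L[ℂ] H) (b : HilbertBasis κ ℂ H) :
    HasSum (fun k => inner ℂ (b k) (A (T (b k)))) (∑' i, inner ℂ (g i) (A (g i))) := by
  -- Absolute summability of the double series, from `x y ≤ x² + y²` and Parseval in each row. The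
  -- two orders of summation then give the two sides.
  have hF : Summable fun p : ι × κ =>
      inner ℂ (g p.1) (b p.2) * inner ℂ (b p.2) (A (g p.1)) := by
    refine Summable.of_norm_bounded (g := fun p : ι × κ =>
      ‖inner ℂ (b p.2) (g p.1)‖ ^ 2 + ‖inner ℂ (b p.2) (A (g p.1))‖ ^ 2) ?_ fun p => ?_
    · have hrow : ∀ i, HasSum (fun k => ‖inner ℂ (b k) (g i)‖ ^ 2 + ‖inner ℂ (b k) (A (g i))‖ ^ 2)
          (‖g i‖ ^ 2 + ‖A (g i)‖ ^ 2) := fun i =>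
        (hasSum_norm_inner_sq b (g i)).add (hasSum_norm_inner_sq b (A (g i)))
      refine (summable_prod_of_nonneg fun p => by positivity).2 ⟨fun i => (hrow i).summable, ?_⟩
      have hA : Summable fun i => ‖A (g i)‖ ^ 2 := by
        refine .of_nonneg_of_le (fun i => by positivity) (fun i => ?_)
          (h.summable.mul_left (‖A‖ ^ 2))
        rw [← mul_pow]
        gcongr
        exact A.le_opNorm _
      exact (h.summable.add hA).congr fun i => (hrow i).tsum_eq.symm
    · rw [norm_mul, norm_inner_symm]
      nlinarith [sq_nonneg (‖inner ℂ (b p.2) (g p.1)‖ - ‖inner ℂ (b p.2) (A (g p.1))‖),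
        sq_nonneg ‖inner ℂ (b p.2) (g p.1)‖, sq_nonneg ‖inner ℂ (b p.2) (A (g p.1))‖]
  have h1 : ∑' p : ι × κ, inner ℂ (g p.1) (b p.2) * inner ℂ (b p.2) (A (g p.1)) =
      ∑' i, inner ℂ (g i) (A (g i)) := by
    rw [hF.tsum_prod]
    exact tsum_congr fun i => b.tsum_inner_mul_inner (g i) (A (g i))
  rw [← h1]
  have h2 := ((Equiv.prodComm κ ι).hasSum_iff.2 hF.hasSum).prod_fiberwise
    (g := fun k => inner ℂ (b k) (A (T (b k)))) fun k => ?_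
  · exact h2
  · have := h.hasSum (ContinuousLinearMap.adjoint A (b k)) (b k)
    simp only [ContinuousLinearMap.adjoint_inner_left] at this
    simpa [mul_comm] using this

theorem IsEnsemble.opTrace_comp [CompleteSpace H] {ι : Type*} {g : ι → H} {T : H →L[ℂ] H}
    (h : IsEnsemble g T) (A : H →L[ℂ] H) :
    opTrace (A ∘L T) = ∑' i, inner ℂ (g i) (A (g i)) :=
  (h.hasSum_trace A (basis H)).tsum_eq

theorem IsEnsemble.map [CompleteSpace H] {ι : Type*} {g : ι → H} {T : H →L[ℂ] H}
    (h : IsEnsemble g T) (U : H →L[ℂ] H) :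
    IsEnsemble (fun i => U (g i)) (U ∘L T ∘L ContinuousLinearMap.adjoint U) where
  summable := .of_nonneg_of_le (fun i => by positivity) (fun i => by
    rw [← mul_pow]
    gcongr
    exact U.le_opNorm _) (h.summable.mul_left (‖U‖ ^ 2))
  hasSum φ ψ := by
    simpa [ContinuousLinearMap.adjoint_inner_left, ContinuousLinearMap.adjoint_inner_right] using
      h.hasSum (ContinuousLinearMap.adjoint U φ) (ContinuousLinearMap.adjoint U ψ)

/-- Apply `√ρ` to an orthonormal basis and discard the zero vectors. A summable family has countable
support, and countability is what later permits exchanging sums with integrals. -/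
theorem IsDensityOperator.exists_isEnsemble [CompleteSpace H] {ρ : H →L[ℂ] H}
    (h : IsDensityOperator ρ) :
    ∃ (ι : Type u) (g : ι → H), Countable ι ∧ IsEnsemble g ρ ∧ HasSum (fun i => ‖g i‖ ^ 2) 1 := by
  have hnn : 0 ≤ ρ := (ContinuousLinearMap.nonneg_iff_isPositive ρ).2 h.isPositive
  set S : H →L[ℂ] H := CFC.sqrt ρ
  have hS : S.IsPositive := (ContinuousLinearMap.nonneg_iff_isPositive S).1 (CFC.sqrt_nonneg ρ)
  have hSS : ∀ φ ψ, inner ℂ (S φ) (S ψ) = inner ℂ φ (ρ ψ) := fun φ ψ => by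
    rw [← CFC.sqrt_mul_sqrt_self ρ hnn, mul_apply_eq_comp]
    exact hS.isSymmetric φ (S ψ)
  obtain ⟨s, b, -⟩ := exists_hilbertBasis ℂ H
  have hsum : HasSum (fun i => ‖S (b i)‖ ^ 2) 1 := by
    have := Complex.hasSum_re (h.hasTrace_one s b)
    simp only [← hSS, inner_self_eq_norm_sq_to_K] at this
    norm_cast at this
  have hsub : Function.support (fun i => ‖S (b i)‖ ^ 2) = {i | S (b i) ≠ 0} := by
    ext i; simp
  refine ⟨{i | S (b i) ≠ 0}, fun i => S (b i), ?_, ⟨?_, fun φ ψ => ?_⟩, ?_⟩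
  · rw [← hsub]
    exact hsum.summable.countable_support.to_subtype
  · exact hsum.summable.subtype _
  · have hb := b.hasSum_inner_mul_inner (S φ) (S ψ)
    rw [hSS] at hb
    have : ∀ i, inner ℂ (S φ) (b i) * inner ℂ (b i) (S ψ) =
        inner ℂ φ (S (b i)) * inner ℂ (S (b i)) ψ := fun i => by
      rw [← hS.isSymmetric.apply_clm, hS.isSymmetric.apply_clm]
    simp only [this] at hb
    refine (hasSum_subtype_iff_of_support_subset fun i hi => ?_).2 hb
    intro h0
    simp [h0] at hi
  · exact (hasSum_subtype_iff_of_support_subset hsub.le).2 hsum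

theorem IsEnsemble.hasTrace [CompleteSpace H] {ι : Type*} {g : ι → H} {T : H →L[ℂ] H}
    (h : IsEnsemble g T) {t : ℝ} (ht : HasSum (fun i => ‖g i‖ ^ 2) t) : HasTrace T t := by
  intro s b
  have h1 := h.hasSum_trace (ContinuousLinearMap.id ℂ H) b
  simp only [ContinuousLinearMap.id_apply, inner_self_eq_norm_sq_to_K] at h1
  have h2 : HasSum (fun i => (‖g i‖ : ℂ) ^ 2) t := by exact_mod_cast Complex.hasSum_ofReal.2 ht
  have h3 := h2.tsum_eq
  rw [← h3]
  exact h1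

theorem IsDensityOperator.conj [CompleteSpace H] {ρ : H →L[ℂ] H} (h : IsDensityOperator ρ)
    (U : H →ₗᵢ[ℂ] H) : IsDensityOperator (U.toContinuousLinearMap ∘L ρ ∘L
      ContinuousLinearMap.adjoint U.toContinuousLinearMap) := by
  obtain ⟨ι, g, -, hg, h1⟩ := h.exists_isEnsemble
  refine ⟨h.isPositive.conj_adjoint _, ?_⟩
  have := (hg.map U.toContinuousLinearMap).hasTrace (t := 1) (by simpa using h1)
  exact_mod_cast this

end Ensemble

/-! ### Tensor products of ensembles -/

theorem norm_tensorVec {n : ℕ} (f g : Modes n) : ‖tensorVec f g‖ = ‖f‖ * ‖g‖ := by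
  rw [← tensorMap_tmul, norm_tensorMap, TensorProduct.norm_tmul]

theorem continuous_tensorVec_left {n : ℕ} (g : Modes n) :
    Continuous fun f : Modes n => tensorVec f g :=
  (LinearMap.mkContinuous (σ := RingHom.id ℂ) ⟨⟨fun f => tensorVec f g,
    fun f f' => tensorVec_add_left f f' g⟩,
    fun c f => tensorVec_smul_left c f g⟩ ‖g‖ fun f =>
      (norm_tensorVec f g).le.trans_eq (mul_comm _ _)).continuous

theorem continuous_tensorVec_right {n : ℕ} (f : Modes n) :
    Continuous fun g : Modes n => tensorVec f g :=
  (LinearMap.mkContinuous (σ := RingHom.id ℂ) ⟨⟨fun g => tensorVec f g,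
    fun g g' => tensorVec_add_right f g g'⟩,
    fun c g => tensorVec_smul_right c f g⟩ ‖f‖ fun g => (norm_tensorVec f g).le).continuous

theorem ext_tensorVec {n : ℕ} {A B : TwoModes n →L[ℂ] TwoModes n}
    (h : ∀ f g, A (tensorVec f g) = B (tensorVec f g)) : A = B := by
  have h1 : A.toLinearMap ∘ₗ tensorMap n = B.toLinearMap ∘ₗ tensorMap n :=
    TensorProduct.ext' h
  refine ContinuousLinearMap.ext fun ψ => congrFun ((denseRange_tensorMap n).equalizer
    A.continuous B.continuous (funext fun u => ?_)) ψ
  exact LinearMap.congr_fun h1 u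

theorem ext_inner_tensorVec {n : ℕ} {A B : TwoModes n →L[ℂ] TwoModes n}
    (h : ∀ f g f' g', inner ℂ (tensorVec f g) (A (tensorVec f' g')) =
      inner ℂ (tensorVec f g) (B (tensorVec f' g'))) : A = B := by
  refine ext_tensorVec fun f' g' => sub_eq_zero.1 (eq_zero_of_inner_tensorVec _ fun f g => ?_)
  rw [inner_sub_right, h, sub_self]

/-- Separate continuity in the four vectors suffices, because density is applied to one slot at a
time. -/
theorem ext_inner_tensorVec_of_dense {n : ℕ} {α : Type*} {s : α → Modes n} (hs : DenseRange s)
    {A B : TwoModes n →L[ℂ] TwoModes n}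
    (h : ∀ a b a' b', inner ℂ (tensorVec (s a) (s b)) (A (tensorVec (s a') (s b'))) =
      inner ℂ (tensorVec (s a) (s b)) (B (tensorVec (s a') (s b')))) : A = B := by
  have hl := continuous_tensorVec_left (n := n)
  have hr := continuous_tensorVec_right (n := n)
  refine ext_inner_tensorVec fun f g f' g' => ?_
  refine congrFun (hs.equalizer ((hl g).inner continuous_const)
    ((hl g).inner continuous_const) (funext fun a => ?_)) f
  refine congrFun (hs.equalizer ((hr (s a)).inner continuous_const)
    ((hr (s a)).inner continuous_const) (funext fun b => ?_)) g
  refine congrFun (hs.equalizer (continuous_const.inner (A.continuous.comp (hl g')))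
    (continuous_const.inner (B.continuous.comp (hl g'))) (funext fun a' => ?_)) f'
  exact congrFun (hs.equalizer (continuous_const.inner (A.continuous.comp (hr (s a'))))
    (continuous_const.inner (B.continuous.comp (hr (s a')))) (funext fun b' => h a b a' b')) g'

/-- The product family is an ensemble for some operator; its matrix elements between product vectors
are products of two absolutely convergent series, which identifies that operator. -/
theorem IsEnsemble.tensor {n : ℕ} {ι κ : Type*} {g : ι → Modes n} {h : κ → Modes n}
    {ρ σ : Modes n →L[ℂ] Modes n} (hg : IsEnsemble g ρ) (hh : IsEnsemble h σ) :
    IsEnsemble (fun p : ι × κ => tensorVec (g p.1) (h p.2)) (tensorOp ρ σ) := by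
  obtain ⟨T, hT⟩ := exists_isEnsemble (fun p : ι × κ => tensorVec (g p.1) (h p.2)) (by
    simp only [norm_tensorVec, mul_pow]
    exact hg.summable.mul_of_nonneg hh.summable (fun _ => by positivity) fun _ => by positivity)
  suffices tensorOp ρ σ = T by rwa [this]
  refine ext_inner_tensorVec fun f₁ f₂ f₁' f₂' => ?_
  have h1 := hT.hasSum (tensorVec f₁ f₂) (tensorVec f₁' f₂')
  rw [tensorOp_tensorVec, inner_tensorVec, ← (hg.hasSum f₁ f₁').tsum_eq,
    ← (hh.hasSum f₂ f₂').tsum_eq, ← h1.tsum_eq,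
    tsum_mul_tsum_of_summable_norm (hg.hasSum f₁ f₁').summable.norm
      (hh.hasSum f₂ f₂').summable.norm]
  refine tsum_congr fun p => ?_
  simp only [inner_tensorVec]
  ring

/-! ### Displacement operators -/

/-- The phase `-(p ⬝ q + p ⬝ x / 2)` in the displacement operator for `r = (x, p)`. -/
def dispPhase {n : ℕ} (r : Phase n) (q : Conf n) : ℝ :=
  -(inner ℝ (momPart r) q + inner ℝ (momPart r) (posPart r) / 2)

theorem continuous_dispPhase {n : ℕ} (r : Phase n) : Continuous (dispPhase r) := by
  unfold dispPhase
  fun_prop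

@[simp] theorem posPart_add {n : ℕ} (r t : Phase n) : posPart (r + t) = posPart r + posPart t := rfl

@[simp] theorem momPart_add {n : ℕ} (r t : Phase n) : momPart (r + t) = momPart r + momPart t := rfl

@[simp] theorem posPart_smul {n : ℕ} (c : ℝ) (r : Phase n) : posPart (c • r) = c • posPart r := rfl

@[simp] theorem momPart_smul {n : ℕ} (c : ℝ) (r : Phase n) : momPart (c • r) = c • momPart r := rfl

@[simp] theorem posPart_neg {n : ℕ} (r : Phase n) : posPart (-r) = -posPart r := rfl

@[simp] theorem momPart_neg {n : ℕ} (r : Phase n) : momPart (-r) = -momPart r := rfl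

@[simp] theorem posPart_zero {n : ℕ} : posPart (0 : Phase n) = 0 := rfl

@[simp] theorem momPart_zero {n : ℕ} : momPart (0 : Phase n) = 0 := rfl

theorem coeFn_phaseMul {n : ℕ} (c : Conf n → ℂ) (hc : Measurable c) (h1 : ∀ q, ‖c q‖ = 1)
    (f : Modes n) : phaseMul c hc h1 f =ᵐ[volume] fun q => c q * f q :=
  MemLp.coeFn_toLp ((Lp.memLp f).of_le (hc.aestronglyMeasurable.mul (Lp.aestronglyMeasurable f))
    (Filter.Eventually.of_forall fun q => by simp [h1]))

/-- Multiplication by the phase in the displacement operator. -/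
def modulation {n : ℕ} (r : Phase n) : Modes n →ₗᵢ[ℂ] Modes n :=
  phaseMul (fun q => Complex.exp (dispPhase r q * Complex.I))
    (by have := continuous_dispPhase r; fun_prop) fun q => Complex.norm_exp_ofReal_mul_I _

theorem displacement_apply {n : ℕ} (r : Phase n) (f : Modes n) :
    displacement r f = modulation r (translation (posPart r) f) := rfl

theorem coeFn_modulation {n : ℕ} (r : Phase n) (f : Modes n) :
    modulation r f =ᵐ[volume] fun q => Complex.exp (dispPhase r q * Complex.I) * f q :=
  coeFn_phaseMul _ _ _ f

theorem coeFn_displacement {n : ℕ} (r : Phase n) (f : Modes n) :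
    displacement r f =ᵐ[volume]
      fun q => Complex.exp (dispPhase r q * Complex.I) * f (q + posPart r) := by
  rw [displacement_apply]
  refine (coeFn_modulation r (translation (posPart r) f)).trans ?_
  filter_upwards [Lp.coeFn_compMeasurePreserving f (measurePreserving_add_right volume (posPart r))]
    with q hq
  exact congrArg (Complex.exp (dispPhase r q * Complex.I) * ·) hq

theorem norm_displacement {n : ℕ} (r : Phase n) (f : Modes n) : ‖displacement r f‖ = ‖f‖ :=
  LinearIsometry.norm_map _ f

theorem inner_displacement_displacement {n : ℕ} (r : Phase n) (f g : Modes n) :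
    inner ℂ (displacement r f) (displacement r g) = inner ℂ f g :=
  LinearIsometry.inner_map_map _ f g

/-- The Weyl relations. -/
theorem displacement_displacement {n : ℕ} (r t : Phase n) (f : Modes n) :
    displacement r (displacement t f) = Complex.exp (((inner ℝ (momPart r) (posPart t) -
      inner ℝ (momPart t) (posPart r)) / 2 : ℝ) * Complex.I) • displacement (r + t) f := by
  apply Lp.ext
  filter_upwards [coeFn_displacement r (displacement t f),
    (measurePreserving_add_right volume (posPart r)).quasiMeasurePreserving.ae
      (coeFn_displacement t f), Lp.coeFn_smul (Complex.exp (((inner ℝ (momPart r) (posPart t) -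
      inner ℝ (momPart t) (posPart r)) / 2 : ℝ) * Complex.I)) (displacement (r + t) f),
    coeFn_displacement (r + t) f] with q h1 h2 h3 h4
  rw [h1, h2, h3, Pi.smul_apply, h4, smul_eq_mul, ← mul_assoc, ← mul_assoc, ← Complex.exp_add,
    ← Complex.exp_add, posPart_add, add_assoc]
  congr 2
  rw [← add_mul, ← add_mul, ← Complex.ofReal_add, ← Complex.ofReal_add]
  congr 2
  simp only [dispPhase, posPart_add, momPart_add, inner_add_left, inner_add_right]
  ring

theorem displacement_zero {n : ℕ} (f : Modes n) : displacement 0 f = f := by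
  apply Lp.ext
  filter_upwards [coeFn_displacement 0 f] with q h1
  simp [h1, dispPhase]

/-- The Weyl phase of the pair `r`, `-r` vanishes, so displacement by `-r` inverts the isometry
`displacement r` and is its adjoint. -/
theorem inner_displacement_neg {n : ℕ} (r : Phase n) (f g : Modes n) :
    inner ℂ f (displacement (-r) g) = inner ℂ (displacement r f) g := by
  rw [← inner_displacement_displacement r, displacement_displacement]
  simp [displacement_zero]

theorem continuous_translation {n : ℕ} (f : Modes n) :
    Continuous fun x : Conf n => translation x f :=
  continuous_const.compMeasurePreservingLp
    (g := fun x : Conf n => (⟨fun q => q + x, by fun_prop⟩ : C(Conf n, Conf n)))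
    (ContinuousMap.continuous_of_continuous_uncurry _ (by
      change Continuous fun p : Conf n × Conf n => p.2 + p.1
      fun_prop))
    (fun x => measurePreserving_add_right volume x) (by norm_num)

theorem continuous_inner_modulation {n : ℕ} (f g : Modes n) :
    Continuous fun r : Phase n => inner ℂ f (modulation r g) := by
  have h : ∀ r : Phase n, inner ℂ f (modulation r g) =
      ∫ q, Complex.exp (dispPhase r q * Complex.I) * inner ℂ (f q) (g q) := fun r => by
    rw [L2.inner_def]
    refine integral_congr_ae ?_
    filter_upwards [coeFn_modulation r g] with q hq
    rw [hq, ← smul_eq_mul, inner_smul_right]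
  simp only [h]
  have hi := L2.integrable_inner (𝕜 := ℂ) f g
  refine continuous_of_dominated (bound := fun q => ‖inner ℂ (f q) (g q)‖) (fun r => ?_)
    (fun r => ?_) hi.norm ?_
  · refine AEStronglyMeasurable.mul ?_ hi.aestronglyMeasurable
    have := continuous_dispPhase r
    exact Continuous.aestronglyMeasurable (by fun_prop)
  · refine Filter.Eventually.of_forall fun q => ?_
    rw [norm_mul, Complex.norm_exp_ofReal_mul_I, one_mul]
  · refine Filter.Eventually.of_forall fun q => ?_
    have hc : Continuous fun r : Phase n => dispPhase r q := by
      unfold dispPhase posPart momPart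
      fun_prop
    fun_prop

/-- Freeze the translation at `r₀`: the error is small in norm by continuity of translation in `L²`,
and the remaining modulation is weakly continuous by dominated convergence. -/
theorem continuous_inner_displacement {n : ℕ} (g : Modes n) :
    Continuous fun r : Phase n => inner ℂ g (displacement r g) := by
  refine continuous_iff_continuousAt.2 fun r₀ => ?_
  have hx : Continuous fun r : Phase n => posPart r := by
    unfold posPart
    fun_prop
  have h1 : Filter.Tendsto (fun r : Phase n => inner ℂ g
      (modulation r (translation (posPart r) g - translation (posPart r₀) g)))
      (nhds r₀) (nhds 0) := by
    have h2 : Filter.Tendsto (fun r : Phase n =>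
        ‖g‖ * ‖translation (posPart r) g - translation (posPart r₀) g‖) (nhds r₀) (nhds 0) := by
      have h3 : Continuous fun r : Phase n =>
          ‖g‖ * ‖translation (posPart r) g - translation (posPart r₀) g‖ :=
        continuous_const.mul (((continuous_translation g).comp hx).sub continuous_const).norm
      simpa using h3.tendsto r₀
    refine squeeze_zero_norm (fun r => ?_) h2
    exact (norm_inner_le_norm _ _).trans_eq (by rw [LinearIsometry.norm_map])
  have h4 := h1.add ((continuous_inner_modulation g (translation (posPart r₀) g)).tendsto r₀)
  rw [zero_add] at h4
  refine h4.congr fun r => ?_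
  rw [← inner_add_right, ← map_add, sub_add_cancel, displacement_apply]

/-! ### Characteristic functions -/

theorem IsEnsemble.charFn_eq {n : ℕ} {ι : Type*} {g : ι → Modes n} {ρ : Modes n →L[ℂ] Modes n}
    (h : IsEnsemble g ρ) (r : Phase n) :
    charFn ρ r = ∑' i, inner ℂ (g i) (displacement r (g i)) :=
  h.opTrace_comp (displacement r)

theorem norm_inner_displacement_le {n : ℕ} (r : Phase n) (g : Modes n) :
    ‖inner ℂ g (displacement r g)‖ ≤ ‖g‖ ^ 2 :=
  (norm_inner_le_norm _ _).trans_eq (by rw [norm_displacement, sq])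

theorem IsDensityOperator.charFn_zero {n : ℕ} {ρ : Modes n →L[ℂ] Modes n}
    (h : IsDensityOperator ρ) : charFn ρ 0 = 1 := by
  have : displacement (n := n) 0 ∘L ρ = ρ := by ext1 f; simp [displacement_zero]
  rw [charFn, this, h.hasTrace_one.opTrace_eq]

theorem IsDensityOperator.continuous_charFn {n : ℕ} {ρ : Modes n →L[ℂ] Modes n}
    (h : IsDensityOperator ρ) : Continuous (charFn ρ) := by
  obtain ⟨ι, g, -, hg, h1⟩ := h.exists_isEnsemble
  rw [funext hg.charFn_eq]
  exact continuous_tsum (fun i => continuous_inner_displacement (g i)) h1.summable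
    fun i r => norm_inner_displacement_le r (g i)

theorem IsDensityOperator.norm_charFn_le {n : ℕ} {ρ : Modes n →L[ℂ] Modes n}
    (h : IsDensityOperator ρ) (r : Phase n) : ‖charFn ρ r‖ ≤ 1 := by
  obtain ⟨ι, g, -, hg, h1⟩ := h.exists_isEnsemble
  rw [hg.charFn_eq]
  exact tsum_of_norm_bounded h1 fun i => norm_inner_displacement_le r (g i)

theorem IsDensityOperator.charFn_neg {n : ℕ} {ρ : Modes n →L[ℂ] Modes n}
    (h : IsDensityOperator ρ) (r : Phase n) :
    charFn ρ (-r) = starRingEnd ℂ (charFn ρ r) := by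
  obtain ⟨ι, g, -, hg, -⟩ := h.exists_isEnsemble
  rw [hg.charFn_eq, hg.charFn_eq, Complex.conj_tsum]
  refine tsum_congr fun i => ?_
  rw [inner_displacement_neg, inner_conj_symm]

/-- Displacing a state multiplies its characteristic function by a phase. -/
theorem IsDensityOperator.charFn_conj_displacement {n : ℕ} {ρ : Modes n →L[ℂ] Modes n}
    (h : IsDensityOperator ρ) (a r : Phase n) :
    charFn (displacement a ∘L ρ ∘L ContinuousLinearMap.adjoint (displacement a)) r =
      Complex.exp ((inner ℝ (momPart r) (posPart a) - inner ℝ (momPart a) (posPart r) : ℝ) *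
        Complex.I) * charFn ρ r := by
  obtain ⟨ι, g, -, hg, -⟩ := h.exists_isEnsemble
  rw [(hg.map (displacement a)).charFn_eq, hg.charFn_eq, ← tsum_mul_left]
  refine tsum_congr fun i => ?_
  have : displacement r (displacement a (g i)) =
      Complex.exp ((inner ℝ (momPart r) (posPart a) - inner ℝ (momPart a) (posPart r) : ℝ) *
        Complex.I) • displacement a (displacement r (g i)) := by
    rw [displacement_displacement, displacement_displacement, smul_smul, ← Complex.exp_add,
      add_comm a r]
    congr 2
    push_cast
    ring
  rw [this, inner_smul_right, inner_displacement_displacement]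

theorem measurePreserving_add_prod {n : ℕ} (x y : Conf n) :
    MeasurePreserving (fun z : Conf n × Conf n => z + (x, y)) volume volume :=
  (measurePreserving_add_right volume x).prod (measurePreserving_add_right volume y)

/-- The displacement operator of two copies. -/
def twoDisplacement {n : ℕ} (r t : Phase n) : TwoModes n →L[ℂ] TwoModes n :=
  tensorOp (displacement r) (displacement t)

/-- Multiplication by a measurable function of modulus one, as an operator on `L²(ℝⁿ × ℝⁿ)`. -/
def twoPhaseMul {n : ℕ} (c : Conf n × Conf n → ℂ) (hc : Measurable c) (h1 : ∀ q, ‖c q‖ = 1) :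
    TwoModes n →ₗᵢ[ℂ] TwoModes n :=
  have hmem : ∀ f : TwoModes n, MemLp (fun q => c q * f q) 2 volume := fun f =>
    (Lp.memLp f).of_le (hc.aestronglyMeasurable.mul (Lp.aestronglyMeasurable f))
      (Filter.Eventually.of_forall fun q => by simp [h1])
  { toFun := fun f => (hmem f).toLp _
    map_add' := fun f g => by
      rw [← MemLp.toLp_add]
      refine MemLp.toLp_congr _ _ ?_
      filter_upwards [Lp.coeFn_add f g] with q hq
      rw [Pi.add_apply, hq, Pi.add_apply, mul_add]
    map_smul' := fun a f => by
      rw [RingHom.id_apply, ← MemLp.toLp_const_smul]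
      refine MemLp.toLp_congr _ _ ?_
      filter_upwards [Lp.coeFn_smul a f] with q hq
      rw [Pi.smul_apply, hq, Pi.smul_apply, smul_eq_mul, smul_eq_mul, mul_left_comm]
    norm_map' := fun f => by
      change ‖(hmem f).toLp _‖ = _
      rw [Lp.norm_toLp, Lp.norm_def]
      congr 1
      exact eLpNorm_congr_norm_ae (Filter.Eventually.of_forall fun q => by simp [h1]) }

theorem coeFn_twoPhaseMul {n : ℕ} (c : Conf n × Conf n → ℂ) (hc : Measurable c)
    (h1 : ∀ q, ‖c q‖ = 1) (f : TwoModes n) :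
    twoPhaseMul c hc h1 f =ᵐ[volume] fun q => c q * f q :=
  MemLp.coeFn_toLp ((Lp.memLp f).of_le (hc.aestronglyMeasurable.mul (Lp.aestronglyMeasurable f))
    (Filter.Eventually.of_forall fun q => by simp [h1]))

/-- The tensor operator is only known on product vectors. The isometry `W` is built from the
pointwise formula, and agreement on product vectors identifies the two. -/
theorem coeFn_twoDisplacement {n : ℕ} (r t : Phase n) (ψ : TwoModes n) :
    twoDisplacement r t ψ =ᵐ[volume] fun z =>
      Complex.exp ((dispPhase r z.1 + dispPhase t z.2 : ℝ) * Complex.I) *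
        ψ (z + (posPart r, posPart t)) := by
  have hm := measurePreserving_add_prod (posPart r) (posPart t)
  have hc : Measurable fun z : Conf n × Conf n =>
      Complex.exp ((dispPhase r z.1 + dispPhase t z.2 : ℝ) * Complex.I) := by
    have h1 := continuous_dispPhase r
    have h2 := continuous_dispPhase t
    exact Continuous.measurable (by fun_prop)
  let W : TwoModes n →ₗᵢ[ℂ] TwoModes n := (twoPhaseMul _ hc fun z =>
    Complex.norm_exp_ofReal_mul_I _).comp (Lp.compMeasurePreservingₗᵢ ℂ _ hm)
  have hW : ∀ ψ : TwoModes n, W ψ =ᵐ[volume] fun z =>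
      Complex.exp ((dispPhase r z.1 + dispPhase t z.2 : ℝ) * Complex.I) *
        ψ (z + (posPart r, posPart t)) := fun ψ => by
    refine (coeFn_twoPhaseMul _ hc (fun z => Complex.norm_exp_ofReal_mul_I _)
      (Lp.compMeasurePreservingₗᵢ ℂ _ hm ψ)).trans ?_
    filter_upwards [Lp.coeFn_compMeasurePreserving ψ hm] with z hz
    exact congrArg (_ * ·) hz
  have : twoDisplacement r t = W.toContinuousLinearMap := by
    refine ext_tensorVec fun f g => ?_
    rw [twoDisplacement, tensorOp_tensorVec]
    apply Lp.ext
    refine Filter.EventuallyEq.trans ?_ (hW (tensorVec f g)).symm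
    filter_upwards [coeFn_tensorVec (displacement r f) (displacement t g),
      hm.quasiMeasurePreserving.ae (coeFn_tensorVec f g), ae_fst (coeFn_displacement r f),
      ae_snd (coeFn_displacement t g)] with z h1 h2 h3 h4
    rw [h1, h2, h3, h4]
    push_cast
    rw [add_mul, Complex.exp_add]
    simp only [Prod.fst_add, Prod.snd_add]
    ring
  rw [this]
  exact hW ψ

theorem IsEnsemble.opTrace_twoDisplacement_tensorOp {n : ℕ} {ι κ : Type*} {g : ι → Modes n}
    {h : κ → Modes n} {ρ σ : Modes n →L[ℂ] Modes n} (hg : IsEnsemble g ρ) (hh : IsEnsemble h σ)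
    (r t : Phase n) :
    opTrace (twoDisplacement r t ∘L tensorOp ρ σ) = charFn ρ r * charFn σ t := by
  rw [(hg.tensor hh).opTrace_comp, hg.charFn_eq, hh.charFn_eq,
    tsum_mul_tsum_of_summable_norm (hg.summable_inner _).norm (hh.summable_inner _).norm]
  simp only [twoDisplacement, tensorOp_tensorVec, inner_tensorVec]

theorem coeFn_rotU {n : ℕ} (θ : ℝ) (ψ : TwoModes n) :
    rotU n θ ψ =ᵐ[volume] fun z => ψ (rot θ z) :=
  Lp.coeFn_compMeasurePreserving ψ (measurePreserving_rot θ)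

/-- Positions and momenta are rotated by the same orthogonal map, so the pairings in the phase are
preserved after summing over both copies. -/
theorem twoDisplacement_rotU {n : ℕ} (θ : ℝ) (r t : Phase n) (ψ : TwoModes n) :
    twoDisplacement r t (rotU n θ ψ) = rotU n θ (twoDisplacement
      (Real.cos θ • r + Real.sin θ • t) (-(Real.sin θ • r) + Real.cos θ • t) ψ) := by
  apply Lp.ext
  filter_upwards [coeFn_twoDisplacement r t (rotU n θ ψ),
    (measurePreserving_add_prod (posPart r) (posPart t)).quasiMeasurePreserving.ae
      (coeFn_rotU θ ψ), coeFn_rotU θ (twoDisplacement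
      (Real.cos θ • r + Real.sin θ • t) (-(Real.sin θ • r) + Real.cos θ • t) ψ),
    (measurePreserving_rot θ).quasiMeasurePreserving.ae (coeFn_twoDisplacement
      (Real.cos θ • r + Real.sin θ • t) (-(Real.sin θ • r) + Real.cos θ • t) ψ)] with z h1 h2 h3 h4
  rw [h1, h2, h3, h4]
  congr 1
  · congr 3
    have h := Real.sin_sq_add_cos_sq θ
    simp only [dispPhase, rot, posPart_add, posPart_smul, posPart_neg, momPart_add, momPart_smul,
      momPart_neg, inner_add_left, inner_add_right, inner_smul_left, inner_smul_right,
      inner_neg_left, inner_neg_right, RCLike.conj_to_real]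
    linear_combination (inner ℝ (momPart r) z.1 + inner ℝ (momPart r) (posPart r) / 2 +
      inner ℝ (momPart t) z.2 + inner ℝ (momPart t) (posPart t) / 2) * h
  · congr 1
    simp only [rot, posPart_add, posPart_smul, posPart_neg, Prod.fst_add, Prod.snd_add,
      Prod.mk_add_mk, smul_add]
    ext1 <;> simp only <;> abel

theorem opTrace_twoDisplacement_rotConj {n : ℕ} {ι : Type*} {g : ι → TwoModes n}
    {T : TwoModes n →L[ℂ] TwoModes n} (h : IsEnsemble g T) (θ : ℝ) (r t : Phase n) :
    opTrace (twoDisplacement r t ∘L rotConj θ T) = opTrace (twoDisplacement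
      (Real.cos θ • r + Real.sin θ • t) (-(Real.sin θ • r) + Real.cos θ • t) ∘L T) := by
  rw [rotConj, (h.map (rotU n θ)).opTrace_comp, h.opTrace_comp]
  refine tsum_congr fun i => ?_
  rw [twoDisplacement_rotU]
  exact LinearIsometry.inner_map_map _ _ _

/-! ### A trace class operator is determined by its characteristic function -/

instance {n : ℕ} : (volume : Measure (Conf n × Conf n)).IsAddLeftInvariant :=
  inferInstanceAs (Measure.prod volume volume).IsAddLeftInvariant

theorem integral_norm_mul_norm_le {α : Type*} [MeasurableSpace α] {μ : Measure α}
    (f g : Lp ℂ 2 μ) : ∫ x, ‖f x‖ * ‖g x‖ ∂μ ≤ ‖f‖ * ‖g‖ := by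
  have hf := (Lp.memLp f).norm
  have hg := (Lp.memLp g).norm
  have h := real_inner_le_norm (hf.toLp _) (hg.toLp _)
  rw [Lp.norm_toLp, Lp.norm_toLp, eLpNorm_norm, eLpNorm_norm, ← Lp.norm_def, ← Lp.norm_def,
    L2.inner_def] at h
  refine (integral_congr_ae ?_).trans_le h
  filter_upwards [hf.coeFn_toLp, hg.coeFn_toLp] with x h1 h2
  rw [h1, h2]
  simp [mul_comm]

/-- The product is again Schwartz in `q`; its inverse Fourier transform is Schwartz, hence
integrable, and serves as `w`. -/
theorem exists_integrable_fourier_eq {n : ℕ} (φ ψ : SchwartzMap (Conf n) ℂ) (x : Conf n) :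
    ∃ w : Conf n → ℂ, Integrable w ∧ ∀ q, starRingEnd ℂ (φ (q + x)) * ψ q =
      ∫ v, Complex.exp ((-2 * Real.pi * inner ℝ v q : ℝ) * Complex.I) * w v := by
  have h1 : Function.HasTemperateGrowth fun q => φ (q + x) :=
    φ.hasTemperateGrowth.comp (by fun_prop)
  have h2 : Function.HasTemperateGrowth fun q => starRingEnd ℂ (φ (q + x)) :=
    (Complex.conjCLE : ℂ →L[ℝ] ℂ).hasTemperateGrowth.comp h1
  let f := SchwartzMap.smulLeftCLM ℂ (fun q => starRingEnd ℂ (φ (q + x))) ψ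
  refine ⟨(𝓕⁻ f : SchwartzMap (Conf n) ℂ), SchwartzMap.integrable _, fun q => ?_⟩
  have h3 : f q = starRingEnd ℂ (φ (q + x)) * ψ q :=
    SchwartzMap.smulLeftCLM_apply_apply h2 ψ q
  rw [← h3, ← FourierTransform.fourier_fourierInv_eq (E := SchwartzMap (Conf n) ℂ)
    (F := SchwartzMap (Conf n) ℂ) f, SchwartzMap.fourier_coe, Real.fourier_eq']
  simp

/-- The point `(x, p)` of phase space. -/
def phasePoint {n : ℕ} (x p : Conf n) : Phase n := Sum.elim x p

@[simp] theorem posPart_phasePoint {n : ℕ} (x p : Conf n) : posPart (phasePoint x p) = x := rfl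

@[simp] theorem momPart_phasePoint {n : ℕ} (x p : Conf n) : momPart (phasePoint x p) = p := rfl

/-- The correlation function `X ↦ ∫ conj Φ(z + X) Ψ(z) conj g(z) g(z + X) dz`. -/
def correlation {n : ℕ} (Φ Ψ g : TwoModes n) (X : Conf n × Conf n) : ℂ :=
  ∫ z, (starRingEnd ℂ (g z) * Ψ z) * (starRingEnd ℂ (Φ (z + X)) * g (z + X))

theorem integrable_conj_mul {α : Type*} [MeasurableSpace α] {μ : Measure α} (f g : Lp ℂ 2 μ) :
    Integrable (fun z => starRingEnd ℂ (f z) * g z) μ :=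
  (L2.integrable_inner (𝕜 := ℂ) f g).congr (Filter.Eventually.of_forall fun z => by
    simp [mul_comm])

theorem inner_eq_integral {α : Type*} [MeasurableSpace α] {μ : Measure α} (f g : Lp ℂ 2 μ) :
    inner ℂ f g = ∫ z, starRingEnd ℂ (f z) * g z ∂μ := by
  rw [L2.inner_def]
  exact integral_congr_ae (Filter.Eventually.of_forall fun z => by simp [mul_comm])

theorem integral_norm_conj_mul_le {α : Type*} [MeasurableSpace α] {μ : Measure α}
    (f g : Lp ℂ 2 μ) : ∫ x, ‖starRingEnd ℂ (f x) * g x‖ ∂μ ≤ ‖f‖ * ‖g‖ := by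
  simpa using integral_norm_mul_norm_le f g

/-- The measure-preserving shear `(z, X) ↦ (z, z + X)` separates the double integral into two inner
products. The `L¹` bound, from Cauchy–Schwarz, is what allows summation over an ensemble. -/
theorem correlation_spec {n : ℕ} (Φ Ψ g : TwoModes n) :
    Integrable (correlation Φ Ψ g) ∧
      ∫ X, correlation Φ Ψ g X = inner ℂ Φ g * inner ℂ g Ψ ∧
      ∫ X, ‖correlation Φ Ψ g X‖ ≤ ‖Φ‖ * ‖Ψ‖ * ‖g‖ ^ 2 := by
  have hmp := measurePreserving_prod_add (volume : Measure (Conf n × Conf n))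
    (volume : Measure (Conf n × Conf n))
  let G : (Conf n × Conf n) × (Conf n × Conf n) → ℂ := fun p =>
    (starRingEnd ℂ (g p.1) * Ψ p.1) * (starRingEnd ℂ (Φ p.2) * g p.2)
  have hG : Integrable G (volume.prod volume) :=
    (integrable_conj_mul g Ψ).mul_prod (integrable_conj_mul Φ g)
  have hG' : Integrable (fun p : (Conf n × Conf n) × (Conf n × Conf n) => G (p.1, p.1 + p.2))
      (volume.prod volume) := hmp.integrable_comp_of_integrable hG
  have hme : MeasurableEmbedding
      (fun p : (Conf n × Conf n) × (Conf n × Conf n) => (p.1, p.1 + p.2)) :=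
    (MeasurableEquiv.shearAddRight (Conf n × Conf n)).measurableEmbedding
  refine ⟨hG'.integral_prod_right, ?_, ?_⟩
  · calc ∫ X, correlation Φ Ψ g X = ∫ p, G (p.1, p.1 + p.2) ∂(volume.prod volume) :=
        (integral_prod_symm _ hG').symm
      _ = ∫ p, G p ∂(volume.prod volume) := hmp.integral_comp hme G
      _ = _ := by
        rw [integral_prod_mul (fun z => starRingEnd ℂ (g z) * Ψ z)
          (fun z => starRingEnd ℂ (Φ z) * g z), inner_eq_integral, inner_eq_integral, mul_comm]
  · calc ∫ X, ‖correlation Φ Ψ g X‖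
        ≤ ∫ X, ∫ z, ‖G (z, z + X)‖ :=
          integral_mono hG'.integral_prod_right.norm hG'.norm.integral_prod_right
            fun X => norm_integral_le_integral_norm _
      _ = ∫ p, ‖G (p.1, p.1 + p.2)‖ ∂(volume.prod volume) :=
        (integral_prod_symm _ hG'.norm).symm
      _ = ∫ p, ‖G p‖ ∂(volume.prod volume) := hmp.integral_comp hme fun p => ‖G p‖
      _ = (∫ z, ‖starRingEnd ℂ (g z) * Ψ z‖) * ∫ z, ‖starRingEnd ℂ (Φ z) * g z‖ := by
        rw [← integral_prod_mul]
        simp only [G, norm_mul]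
      _ ≤ (‖g‖ * ‖Ψ‖) * (‖Φ‖ * ‖g‖) :=
        mul_le_mul (integral_norm_conj_mul_le g Ψ) (integral_norm_conj_mul_le Φ g)
          (integral_nonneg fun _ => norm_nonneg _) (by positivity)
      _ = _ := by ring

theorem inner_twoDisplacement_eq_integral {n : ℕ} (g : TwoModes n) (r t : Phase n) :
    inner ℂ g (twoDisplacement r t g) = ∫ z, Complex.exp
      ((dispPhase r z.1 + dispPhase t z.2 : ℝ) * Complex.I) *
        (starRingEnd ℂ (g z) * g (z + (posPart r, posPart t))) := by
  rw [inner_eq_integral]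
  refine integral_congr_ae ?_
  filter_upwards [coeFn_twoDisplacement r t g] with z hz
  rw [hz]
  ring

/-- Translation `(T ψ)(z) = ψ(z + X)` on `L²(ℝⁿ × ℝⁿ)`. -/
def twoTranslation {n : ℕ} (X : Conf n × Conf n) : TwoModes n →ₗᵢ[ℂ] TwoModes n :=
  Lp.compMeasurePreservingₗᵢ ℂ (fun z => z + (X.1, X.2)) (measurePreserving_add_prod X.1 X.2)

theorem coeFn_twoTranslation {n : ℕ} (X : Conf n × Conf n) (g : TwoModes n) :
    twoTranslation X g =ᵐ[volume] fun z => g (z + X) :=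
  Lp.coeFn_compMeasurePreserving g (measurePreserving_add_prod X.1 X.2)

theorem norm_twoDisplacement {n : ℕ} (r t : Phase n) (g : TwoModes n) :
    ‖inner ℂ g (twoDisplacement r t g)‖ ≤ ‖g‖ ^ 2 := by
  rw [inner_twoDisplacement_eq_integral]
  refine (norm_integral_le_integral_norm _).trans ?_
  refine le_trans (integral_congr_ae ?_).le
    ((integral_norm_mul_norm_le g (twoTranslation (posPart r, posPart t) g)).trans_eq ?_)
  · filter_upwards [coeFn_twoTranslation (posPart r, posPart t) g] with z hz
    rw [norm_mul, Complex.norm_exp_ofReal_mul_I, one_mul, norm_mul, RCLike.norm_conj, hz]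
  · rw [LinearIsometry.norm_map, sq]

/-- The correlation function against Schwartz tensors is an integral of matrix elements of
displacement operators. -/
theorem exists_correlation_eq_integral {n : ℕ} (φ₁ φ₂ ψ₁ ψ₂ : SchwartzMap (Conf n) ℂ)
    (X : Conf n × Conf n) :
    ∃ k : Conf n × Conf n → ℂ, Integrable k ∧ ∀ g : TwoModes n,
      Integrable (fun V => k V * inner ℂ g (twoDisplacement (phasePoint X.1 ((2 * Real.pi) • V.1))
        (phasePoint X.2 ((2 * Real.pi) • V.2)) g)) ∧
      correlation (tensorVec (φ₁.toLp 2 volume) (φ₂.toLp 2 volume))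
          (tensorVec (ψ₁.toLp 2 volume) (ψ₂.toLp 2 volume)) g X =
        ∫ V, k V * inner ℂ g (twoDisplacement (phasePoint X.1 ((2 * Real.pi) • V.1))
          (phasePoint X.2 ((2 * Real.pi) • V.2)) g) := by
  obtain ⟨w₁, hw₁, h₁⟩ := exists_integrable_fourier_eq φ₁ ψ₁ X.1
  obtain ⟨w₂, hw₂, h₂⟩ := exists_integrable_fourier_eq φ₂ ψ₂ X.2
  -- Compensates the half-phase `p ⬝ x / 2` of the displacement operators at momentum `p = 2 π V`.
  let c : Conf n × Conf n → ℝ := fun V => Real.pi * (inner ℝ V.1 X.1 + inner ℝ V.2 X.2)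
  have hcont : Continuous fun V => Complex.exp (c V * Complex.I) := by
    simp only [c]
    fun_prop
  have hw : Integrable (fun V : Conf n × Conf n => w₁ V.1 * w₂ V.2) := hw₁.mul_prod hw₂
  refine ⟨fun V => Complex.exp (c V * Complex.I) * (w₁ V.1 * w₂ V.2),
    hw.bdd_mul hcont.aestronglyMeasurable
      (Filter.Eventually.of_forall fun V => (Complex.norm_exp_ofReal_mul_I _).le), fun g => ?_⟩
  let e : (Conf n × Conf n) × (Conf n × Conf n) → ℝ := fun p =>
    -2 * Real.pi * inner ℝ p.1.1 p.2.1 + -2 * Real.pi * inner ℝ p.1.2 p.2.2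
  have he : Continuous fun p => Complex.exp (e p * Complex.I) := by
    simp only [e]
    fun_prop
  have hg : Integrable fun z => starRingEnd ℂ (g z) * g (z + X) := by
    refine (integrable_conj_mul g (twoTranslation X g)).congr ?_
    filter_upwards [coeFn_twoTranslation X g] with z hz
    rw [hz]
  -- Fubini for `F` gives the claim: integrating out `z` produces displacement matrix elements,
  -- integrating out `V` reassembles the Schwartz products. The kernel was chosen before `g`, so it
  -- is common to all vectors.
  let F : (Conf n × Conf n) × (Conf n × Conf n) → ℂ := fun p => Complex.exp (e p * Complex.I) *
    ((w₁ p.1.1 * w₂ p.1.2) * (starRingEnd ℂ (g p.2) * g (p.2 + X)))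
  have hF : Integrable F (volume.prod volume) :=
    (hw.mul_prod hg).bdd_mul he.aestronglyMeasurable
      (Filter.Eventually.of_forall fun V => (Complex.norm_exp_ofReal_mul_I _).le)
  have hleft : ∀ V : Conf n × Conf n, ∫ z, F (V, z) =
      Complex.exp (c V * Complex.I) * (w₁ V.1 * w₂ V.2) *
        inner ℂ g (twoDisplacement (phasePoint X.1 ((2 * Real.pi) • V.1))
          (phasePoint X.2 ((2 * Real.pi) • V.2)) g) := fun V => by
    rw [inner_twoDisplacement_eq_integral, ← integral_const_mul]
    refine integral_congr_ae (Filter.Eventually.of_forall fun z => ?_)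
    have : (e (V, z) : ℂ) = c V + (dispPhase (phasePoint X.1 ((2 * Real.pi) • V.1)) z.1 +
        dispPhase (phasePoint X.2 ((2 * Real.pi) • V.2)) z.2 : ℝ) := by
      rw [← Complex.ofReal_add]
      congr 1
      simp only [e, c, dispPhase, posPart_phasePoint, momPart_phasePoint, inner_smul_left,
        RCLike.conj_to_real]
      ring
    simp only [F, this, add_mul, Complex.exp_add, posPart_phasePoint]
    ring
  have hright : ∀ z : Conf n × Conf n, ∫ V, F (V, z) =
      ((starRingEnd ℂ (φ₁ (z.1 + X.1)) * ψ₁ z.1) * (starRingEnd ℂ (φ₂ (z.2 + X.2)) * ψ₂ z.2)) *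
        (starRingEnd ℂ (g z) * g (z + X)) := fun z => by
    rw [h₁, h₂, ← integral_prod_mul, ← integral_mul_const]
    refine integral_congr_ae (Filter.Eventually.of_forall fun V => ?_)
    simp only [F, e]
    rw [Complex.ofReal_add, add_mul, Complex.exp_add]
    ring
  constructor
  · exact hF.integral_prod_left.congr (Filter.Eventually.of_forall hleft)
  · rw [← integral_congr_ae (Filter.Eventually.of_forall hleft), correlation,
      integral_integral_swap (f := fun V z => F (V, z)) hF]
    refine integral_congr_ae ?_
    filter_upwards [coeFn_tensorVec (ψ₁.toLp 2 volume) (ψ₂.toLp 2 volume),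
      ae_fst (ψ₁.coeFn_toLp 2 volume),
      ae_snd (ψ₂.coeFn_toLp 2 volume),
      (measurePreserving_add_prod X.1 X.2).quasiMeasurePreserving.ae
        (coeFn_tensorVec (φ₁.toLp 2 volume) (φ₂.toLp 2 volume)),
      (measurePreserving_add_prod X.1 X.2).quasiMeasurePreserving.ae
        (ae_fst (φ₁.coeFn_toLp 2 volume)),
      (measurePreserving_add_prod X.1 X.2).quasiMeasurePreserving.ae
        (ae_snd (φ₂.coeFn_toLp 2 volume))] with z e1 e2 e3 e4 e5 e6
    rw [hright, e1, e4, e2, e3, e5, e6, map_mul, Prod.fst_add, Prod.snd_add]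
    ring

theorem IsEnsemble.hasSum_correlation {n : ℕ} {ι : Type*} [Countable ι] {g : ι → TwoModes n}
    {T : TwoModes n →L[ℂ] TwoModes n} (h : IsEnsemble g T) (Φ Ψ : TwoModes n) :
    inner ℂ Φ (T Ψ) = ∫ X, ∑' i, correlation Φ Ψ (g i) X := by
  rw [← (h.hasSum Φ Ψ).tsum_eq, ← integral_tsum_of_summable_integral_norm
    (fun i => (correlation_spec Φ Ψ (g i)).1)
    (.of_nonneg_of_le (fun i => integral_nonneg fun _ => norm_nonneg _)
      (fun i => (correlation_spec Φ Ψ (g i)).2.2) (h.summable.mul_left _))]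
  exact tsum_congr fun i => (correlation_spec Φ Ψ (g i)).2.1.symm

/-- Domination by `‖k V‖ * ‖g i‖ ^ 2` lets the sum enter the integral, after which the ensemble
appears only through its characteristic function. -/
theorem IsEnsemble.tsum_integral_twoDisplacement {n : ℕ} {ι : Type*} [Countable ι]
    {g : ι → TwoModes n} {T : TwoModes n →L[ℂ] TwoModes n} (h : IsEnsemble g T)
    {k : Conf n × Conf n → ℂ} (hk : Integrable k) (r t : Conf n × Conf n → Phase n)
    (hi : ∀ i, Integrable fun V => k V * inner ℂ (g i) (twoDisplacement (r V) (t V) (g i))) :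
    ∑' i, ∫ V, k V * inner ℂ (g i) (twoDisplacement (r V) (t V) (g i)) =
      ∫ V, k V * opTrace (twoDisplacement (r V) (t V) ∘L T) := by
  rw [integral_tsum_of_summable_integral_norm hi]
  · simp only [h.opTrace_comp, tsum_mul_left]
  · refine .of_nonneg_of_le (fun i => integral_nonneg fun _ => norm_nonneg _)
      (fun i => ?_) (h.summable.mul_left (∫ V, ‖k V‖))
    rw [← integral_mul_const]
    refine integral_mono (hi i).norm (hk.norm.mul_const _) fun V => ?_
    simp only [norm_mul]
    gcongr
    exact norm_twoDisplacement _ _ _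

/-- A positive trace class operator on `L²(ℝⁿ × ℝⁿ)` is determined by its characteristic
function. -/
theorem IsEnsemble.eq_of_opTrace_twoDisplacement {n : ℕ} {ι κ : Type*} [Countable ι] [Countable κ]
    {g : ι → TwoModes n} {h : κ → TwoModes n} {T T' : TwoModes n →L[ℂ] TwoModes n}
    (hg : IsEnsemble g T) (hh : IsEnsemble h T')
    (heq : ∀ r t, opTrace (twoDisplacement r t ∘L T) = opTrace (twoDisplacement r t ∘L T')) :
    T = T' := by
  refine ext_inner_tensorVec_of_dense
    (SchwartzMap.denseRange_toLpCLM (F := ℂ) (μ := (volume : Measure (Conf n)))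
      ENNReal.ofNat_ne_top) fun φ₁ φ₂ ψ₁ ψ₂ => ?_
  rw [hg.hasSum_correlation, hh.hasSum_correlation]
  -- For each fixed `X` both integrands are integrals of the same kernel against the respective
  -- characteristic functions.
  refine integral_congr_ae (Filter.Eventually.of_forall fun X => ?_)
  obtain ⟨k, hk, hX⟩ := exists_correlation_eq_integral φ₁ φ₂ ψ₁ ψ₂ X
  simp only [SchwartzMap.toLpCLM_apply, (hX _).2]
  rw [hg.tsum_integral_twoDisplacement hk _ _ fun i => (hX _).1,
    hh.tsum_integral_twoDisplacement hk _ _ fun i => (hX _).1]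
  simp only [heq]

/-! ### The functional equation of Gaussian functions -/

/-- A continuous homomorphism from `ℝ` to the multiplicative group of `ℂ` is an exponential. -/
theorem exists_eq_exp_of_map_add {w : ℝ → ℂ} (hw : Continuous w) (h0 : w 0 = 1)
    (hadd : ∀ s t, w (s + t) = w s * w t) : ∃ z : ℂ, ∀ t : ℝ, w t = Complex.exp (z * t) := by
  let F : ℝ → ℂ := fun s => ∫ t in (0 : ℝ)..s, w t
  have hF : ∀ s, HasDerivAt F (w s) s := fun s => hw.integral_hasStrictDerivAt 0 s |>.hasDerivAt
  obtain ⟨a, ha⟩ : ∃ a, F a ≠ 0 := by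
    by_contra! hall
    have h1 := (hF 0).unique ((hasDerivAt_const (0 : ℝ) (0 : ℂ)).congr_of_eventuallyEq
      (Filter.Eventually.of_forall hall))
    rw [h0] at h1
    exact one_ne_zero h1
  -- Regularization: integrating `w (s + t) = w s * w t` over `t` expresses `w` through its
  -- primitive, so the continuous `w` is differentiable.
  have hwF : ∀ s, w s = (F (s + a) - F s) / F a := fun s => by
    rw [eq_div_iff ha, intervalIntegral.integral_interval_sub_left (hw.intervalIntegrable _ _)
      (hw.intervalIntegrable _ _), ← intervalIntegral.integral_const_mul]
    have := intervalIntegral.integral_comp_add_left (f := w) (a := 0) (b := a) s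
    rw [add_zero] at this
    rw [← this]
    simp only [hadd]
  let z : ℂ := (w a - 1) / F a
  have hd : ∀ s, HasDerivAt w (w s * z) s := fun s => by
    have h1 := (((hF (s + a)).comp_add_const s a).sub (hF s)).div_const (F a)
    have h2 : (w (s + a) - w s) / F a = w s * z := by
      rw [hadd]
      simp only [z]
      ring
    rw [← h2]
    exact h1.congr_of_eventuallyEq (Filter.Eventually.of_forall hwF)
  refine ⟨z, fun t => ?_⟩
  have hd2 : ∀ s : ℝ, HasDerivAt (fun s : ℝ => w s * Complex.exp (-z * s)) 0 s := fun s => by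
    have h1 : HasDerivAt (fun s : ℝ => Complex.exp (-z * s)) (Complex.exp (-z * s) * (-z)) s := by
      simpa using ((Complex.ofRealCLM.hasDerivAt (x := s)).const_mul (-z)).cexp
    have h2 := (hd s).mul h1
    have h3 : w s * z * Complex.exp (-z * s) + w s * (Complex.exp (-z * s) * (-z)) = 0 := by ring
    rwa [h3] at h2
  have hconst := is_const_of_deriv_eq_zero (fun s => (hd2 s).differentiableAt)
    (fun s => (hd2 s).deriv) t 0
  simp only [h0, Complex.ofReal_zero, mul_zero, Complex.exp_zero, mul_one, neg_mul,
    Complex.exp_neg] at hconst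
  rwa [mul_inv_eq_one₀ (Complex.exp_ne_zero _)] at hconst

section

variable {ι : Type*} [Fintype ι] [DecidableEq ι]

/-- A continuous unitary character of `ℝ^ι` is `r ↦ exp(i ℓ ⬝ r)`. -/
theorem exists_eq_exp_dotProduct {w : (ι → ℝ) → ℂ} (hw : Continuous w) (hn : ∀ r, ‖w r‖ = 1)
    (hadd : ∀ r t, w (r + t) = w r * w t) :
    ∃ ℓ : ι → ℝ, ∀ r, w r = Complex.exp ((r ⬝ᵥ ℓ : ℝ) * Complex.I) := by
  have hne : ∀ r, w r ≠ 0 := fun r h => by simpa [h] using hn r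
  have h0 : w 0 = 1 := by
    have := hadd 0 0
    rw [add_zero] at this
    exact (mul_eq_left₀ (hne 0)).1 this.symm
  have h1 : ∀ j : ι, ∃ x : ℝ, ∀ t : ℝ, w (t • Pi.single j 1) =
      Complex.exp ((t * x : ℝ) * Complex.I) := fun j => by
    obtain ⟨z, hz⟩ := exists_eq_exp_of_map_add (w := fun t : ℝ => w (t • Pi.single j 1))
      (by fun_prop) (by simp [h0]) fun s t => by rw [add_smul, hadd]
    have hre : z.re = 0 := by
      have h2 := hn ((1 : ℝ) • Pi.single j 1)
      rw [hz 1, Complex.norm_exp] at h2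
      simpa using h2
    refine ⟨z.im, fun t => ?_⟩
    rw [hz t]
    congr 1
    apply Complex.ext <;> simp [hre, mul_comm]
  choose ℓ hℓ using h1
  refine ⟨ℓ, fun r => ?_⟩
  have hsum : ∀ s : Finset ι, w (∑ j ∈ s, r j • Pi.single j 1) =
      Complex.exp ((∑ j ∈ s, r j * ℓ j : ℝ) * Complex.I) := fun s => by
    induction s using Finset.induction_on with
    | empty => simp [h0]
    | insert j s hj ih =>
      rw [Finset.sum_insert hj, Finset.sum_insert hj, hadd, ih, hℓ, ← Complex.exp_add,
        Complex.ofReal_add, add_mul]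
  have h2 := hsum Finset.univ
  rwa [← pi_eq_sum_univ' r] at h2

/-- A continuous even solution of the quadratic functional equation is a quadratic form. -/
theorem exists_eq_dotProduct_mulVec {f : (ι → ℝ) → ℝ} (hf : Continuous f)
    (heven : ∀ r, f (-r) = f r) (hquad : ∀ a u v,
      f (a + u + v) + f a + f u + f v = f (a + u) + f (a + v) + f (u + v)) :
    ∃ B : Matrix ι ι ℝ, B.IsSymm ∧ ∀ r, f r = r ⬝ᵥ B.mulVec r := by
  -- The hypothesis says that the polarization of `f` is additive in one slot; symmetry and
  -- continuity upgrade this to real bilinearity.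
  have hadd : ∀ v a u, f (a + u + v) - f (a + u) - f v =
      (f (a + v) - f a - f v) + (f (u + v) - f u - f v) := fun v a u => by
    linarith [hquad a u v]
  have h0 : f 0 = 0 := by
    have := hquad 0 0 0
    simp only [add_zero] at this
    linarith
  let M₁ : (ι → ℝ) → (ι → ℝ) →ₗ[ℝ] ℝ := fun v =>
    ((AddMonoidHom.mk' (fun u => f (u + v) - f u - f v) (hadd v)).toRealLinearMap
      (by change Continuous fun u => f (u + v) - f u - f v; fun_prop)).toLinearMap
  have hM₁ : ∀ u v, M₁ v u = f (u + v) - f u - f v := fun _ _ => rfl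
  have hcomm : ∀ u v, M₁ v u = M₁ u v := fun u v => by rw [hM₁, hM₁, add_comm u v]; ring
  let M : (ι → ℝ) →ₗ[ℝ] (ι → ℝ) →ₗ[ℝ] ℝ := LinearMap.mk₂ ℝ (fun u v => M₁ v u)
    (fun u u' v => map_add _ _ _) (fun c u v => map_smul _ _ _)
    (fun u v v' => by simp only [hcomm u, map_add]) (fun c u v => by simp only [hcomm u, map_smul])
  have hM : ∀ u v, M u v = f (u + v) - f u - f v := fun _ _ => rfl
  refine ⟨(1 / 2 : ℝ) • LinearMap.toMatrix₂' ℝ M, ?_, fun r => ?_⟩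
  · ext i j
    simp only [Matrix.transpose_apply, Matrix.smul_apply, LinearMap.toMatrix₂'_apply]
    rw [show M _ _ = M _ _ from hcomm _ _]
  · have h1 : r ⬝ᵥ (LinearMap.toMatrix₂' ℝ M).mulVec r = M r r := by
      rw [← Matrix.toLinearMap₂'_apply', Matrix.toLinearMap₂'_toMatrix']
    have h2 : M r (-r) = - (2 * f r) := by rw [hM, heven, add_neg_cancel, h0]; ring
    rw [map_neg] at h2
    rw [Matrix.smul_mulVec, dotProduct_smul, h1, smul_eq_mul]
    linarith

end

section

variable {E : Type*} [NormedAddCommGroup E] [NormedSpace ℝ E]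

/-- The functional equation of independence of rotated coordinates forces `φ` to be nonvanishing. -/
theorem ne_zero_of_rotation_eq {φ : E → ℂ} (hφ : Continuous φ) (h0 : φ 0 = 1) {c s : ℝ}
    (hcs : c ^ 2 + s ^ 2 = 1) (hc : c ≠ 0) (hs : s ≠ 0) {A B : E → ℂ}
    (h : ∀ r t, φ (c • r + s • t) * φ (-(s • r) + c • t) = A r * B t) (a : E) : φ a ≠ 0 := by
  have hAB : A 0 * B 0 = 1 := by simpa [h0] using (h 0 0).symm
  -- Evaluate the equation at `(c a, s a)`, which rotates to `(a, 0)`, and at `(c a, 0)` and `(0, s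
  -- a)`. Every argument on the right is shorter than `a` by a factor of at most `max |c| |s| < 1`.
  have key : ∀ a, φ a =
      (φ ((c * c) • a) * φ (-(s * c) • a)) * (φ ((s * s) • a) * φ ((c * s) • a)) := by
    intro a
    have h1 := h (c • a) (s • a)
    have h2 := h (c • a) 0
    have h3 := h 0 (s • a)
    simp only [smul_zero, add_zero, zero_add, neg_zero, smul_smul] at h1 h2 h3
    rw [← add_smul, ← neg_smul, ← add_smul, show c * c + s * s = 1 by linarith,
      show -(s * c) + c * s = 0 by ring, one_smul, zero_smul, h0, mul_one] at h1
    rw [← neg_smul] at h2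
    rw [h1, h2, h3]
    linear_combination (-(A (c • a) * B (s • a))) * hAB
  obtain ⟨δ, hδ, hball⟩ := Metric.eventually_nhds_iff.1
    (hφ.continuousAt.eventually_ne (x := (0 : E)) (by rw [h0]; exact one_ne_zero))
  set q := max |c| |s| with hq
  have hc0 := abs_pos.2 hc
  have hs0 := abs_pos.2 hs
  have hc1 : |c| < 1 := by
    rw [← sq_lt_one_iff₀ (abs_nonneg c), sq_abs]
    have := sq_pos_of_pos hs0
    rw [sq_abs] at this
    linarith
  have hs1 : |s| < 1 := by
    rw [← sq_lt_one_iff₀ (abs_nonneg s), sq_abs]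
    have := sq_pos_of_pos hc0
    rw [sq_abs] at this
    linarith
  have hq1 : q < 1 := max_lt hc1 hs1
  have hq0 : 0 ≤ q := (abs_nonneg c).trans (le_max_left _ _)
  have hcq : |c| ≤ q := le_max_left _ _
  have hsq : |s| ≤ q := le_max_right _ _
  -- Induction on the number of contractions needed to reach the ball around `0` where continuity
  -- prevents zeros.
  have hmain : ∀ k : ℕ, ∀ a : E, q ^ k * ‖a‖ < δ → φ a ≠ 0 := by
    intro k
    induction k with
    | zero => exact fun a ha => hball (by simpa using ha)
    | succ k ih =>
      intro a ha
      have hsmall : ∀ x : ℝ, |x| ≤ q → φ (x • a) ≠ 0 := fun x hx => by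
        refine ih _ (lt_of_le_of_lt ?_ ha)
        rw [norm_smul, Real.norm_eq_abs, pow_succ, mul_assoc]
        gcongr
      rw [key a]
      refine mul_ne_zero (mul_ne_zero ?_ ?_) (mul_ne_zero ?_ ?_) <;> apply hsmall
      · rw [abs_mul]; nlinarith
      · rw [abs_neg, abs_mul]; nlinarith
      · rw [abs_mul]; nlinarith
      · rw [abs_mul]; nlinarith
  have hlim : Filter.Tendsto (fun k : ℕ => q ^ k * ‖a‖) Filter.atTop (nhds 0) := by
    simpa using (tendsto_pow_atTop_nhds_zero_of_lt_one hq0 hq1).mul_const ‖a‖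
  obtain ⟨k, hk⟩ := (hlim.eventually_lt_const hδ).exists
  exact hmain k a hk

/-- The functional equation of independence of rotated coordinates makes the second multiplicative
differences of `φ` constant. -/
theorem quadratic_of_rotation_eq {φ : E → ℂ} (h0 : φ 0 = 1) (hne : ∀ a, φ a ≠ 0) {c s : ℝ}
    (hcs : c ^ 2 + s ^ 2 = 1) (hc : c ≠ 0) (hs : s ≠ 0) {A B : E → ℂ}
    (h : ∀ r t, φ (c • r + s • t) * φ (-(s • r) + c • t) = A r * B t) (a u v : E) :
    φ (a + u + v) * φ a * φ u * φ v = φ (a + u) * φ (a + v) * φ (u + v) := by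
  -- Exchanging `t` and `t'` leaves the product of two values of `A r * B t` unchanged, which
  -- eliminates `A` and `B`.
  have hmix : ∀ r t r' t' a b a₁ b₁ a₂ b₂ a₃ b₃, c • r + s • t = a → -(s • r) + c • t = b →
      c • r' + s • t' = a₁ → -(s • r') + c • t' = b₁ → c • r' + s • t = a₂ →
      -(s • r') + c • t = b₂ → c • r + s • t' = a₃ → -(s • r) + c • t' = b₃ →
      (φ a₁ * φ b₁) * (φ a * φ b) = (φ a₂ * φ b₂) * (φ a₃ * φ b₃) := by
    rintro r t r' t' _ _ _ _ _ _ _ _ rfl rfl rfl rfl rfl rfl rfl rfl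
    rw [h, h, h, h]
    ring
  have hstep : ∀ a, (φ (a + u + v) * φ (-((s / c) • u) + (c / s) • v)) * (φ a * φ 0) =
      (φ (a + u) * φ (-((s / c) • u))) * (φ (a + v) * φ ((c / s) • v)) := by
    intro a
    -- The base point rotates to `(a, 0)`; the increments add `u` and `v` to the first coordinate.
    -- The second coordinates do not involve `a`, so comparison with the case `a = 0` removes them.
    refine hmix (c • a) (s • a) (c • a + c⁻¹ • u) (s • a + s⁻¹ • v) _ _ _ _ _ _ _ _
      ?_ ?_ ?_ ?_ ?_ ?_ ?_ ?_
    all_goals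
      match_scalars <;> field_simp <;> linarith
  have h1 := hstep a
  have h2 := hstep 0
  simp only [zero_add, h0, mul_one] at h1 h2
  have hp := hne (-((s / c) • u) + (c / s) • v)
  have hw : φ (-((s / c) • u)) * φ ((c / s) • v) ≠ 0 := mul_ne_zero (hne _) (hne _)
  refine mul_right_cancel₀ (mul_ne_zero hp hw) ?_
  linear_combination (φ u * φ v * (φ (-((s / c) • u)) * φ ((c / s) • v))) * h1 -
    (φ (a + u) * φ (a + v) * (φ (-((s / c) • u)) * φ ((c / s) • v))) * h2

/-- A phase with constant second multiplicative differences is a character. -/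
theorem map_add_of_quadratic {w : E → ℂ} (hne : ∀ a, w a ≠ 0) (h0 : w 0 = 1)
    (hinv : ∀ a, w (-a) = (w a)⁻¹)
    (h : ∀ a u v, w (a + u + v) * w a * w u * w v = w (a + u) * w (a + v) * w (u + v)) (u v : E) :
    w (u + v) = w u * w v := by
  -- Taking `a = -(u + v)` gives additivity only up to sign.
  have hsq : ∀ u v, w (u + v) ^ 2 = (w u * w v) ^ 2 := fun u v => by
    have h1 := h (-(u + v)) u v
    rw [show -(u + v) + u + v = 0 by abel, show -(u + v) + u = -v by abel,
      show -(u + v) + v = -u by abel, h0, hinv, hinv, hinv] at h1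
    have := hne u
    have := hne v
    have := hne (u + v)
    field_simp at h1
    linear_combination -h1
  -- Halving `u` removes the sign ambiguity: here `w (u / 2 + v)` enters only through its square.
  have h2 := h ((1 / 2 : ℝ) • u) ((1 / 2 : ℝ) • u) v
  rw [show (1 / 2 : ℝ) • u + (1 / 2 : ℝ) • u = u by rw [← add_smul]; norm_num] at h2
  have h3 := hsq ((1 / 2 : ℝ) • u) v
  refine mul_right_cancel₀ (mul_ne_zero (pow_ne_zero 2 (hne ((1 / 2 : ℝ) • u))) (hne v)) ?_
  linear_combination h2 + w u * h3

end

/-- A continuous solution of the functional equation of independence of rotated coordinates is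
Gaussian. -/
theorem exists_gaussian_of_rotation_eq {ι : Type*} [Fintype ι] [DecidableEq ι]
    {φ : (ι → ℝ) → ℂ} (hφ : Continuous φ) (h0 : φ 0 = 1) (hle : ∀ r, ‖φ r‖ ≤ 1)
    (hconj : ∀ r, φ (-r) = starRingEnd ℂ (φ r)) {c s : ℝ}
    (hcs : c ^ 2 + s ^ 2 = 1) (hc : c ≠ 0) (hs : s ≠ 0) {A B : (ι → ℝ) → ℂ}
    (h : ∀ r t, φ (c • r + s • t) * φ (-(s • r) + c • t) = A r * B t) :
    ∃ (Q : Matrix ι ι ℝ) (ℓ : ι → ℝ), Q.PosSemidef ∧ ∀ r, φ r =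
      Complex.exp ((-(1 / 4) * (r ⬝ᵥ Q.mulVec r) : ℝ) + (r ⬝ᵥ ℓ : ℝ) * Complex.I) := by
  have hne := ne_zero_of_rotation_eq hφ h0 hcs hc hs h
  have hquad := quadratic_of_rotation_eq h0 hne hcs hc hs h
  have hn : ∀ r, ‖φ r‖ ≠ 0 := fun r => norm_ne_zero_iff.2 (hne r)
  have hn' : ∀ r, (‖φ r‖ : ℂ) ≠ 0 := fun r => Complex.ofReal_ne_zero.2 (hn r)
  have hnorm : ∀ a u v, ‖φ (a + u + v)‖ * ‖φ a‖ * ‖φ u‖ * ‖φ v‖ =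
      ‖φ (a + u)‖ * ‖φ (a + v)‖ * ‖φ (u + v)‖ := fun a u v => by
    simpa only [norm_mul] using congrArg norm (hquad a u v)
  -- The factor `-4` matches the normalization `-1/4` of the Gaussian exponent and makes the form
  -- nonnegative, since `‖φ r‖ ≤ 1`.
  obtain ⟨Q, hQs, hQ⟩ := exists_eq_dotProduct_mulVec (f := fun r => -4 * Real.log ‖φ r‖)
    (continuous_const.mul (hφ.norm.log hn)) (fun r => by rw [hconj, RCLike.norm_conj])
    fun a u v => by
      have h1 := congrArg Real.log (hnorm a u v)
      simp only [Real.log_mul, ne_eq, mul_eq_zero, hn, or_self, not_false_eq_true] at h1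
      linarith
  let w : (ι → ℝ) → ℂ := fun r => φ r / ‖φ r‖
  have hw1 : ∀ r, ‖w r‖ = 1 := fun r => by simp [w, hn r]
  have hwne : ∀ r, w r ≠ 0 := fun r => div_ne_zero (hne r) (hn' r)
  obtain ⟨ℓ, hℓ⟩ := exists_eq_exp_dotProduct (w := w)
    (hφ.div (Complex.continuous_ofReal.comp hφ.norm) hn') hw1
    (map_add_of_quadratic hwne (by simp [w, h0]) (fun r => by
      refine eq_inv_of_mul_eq_one_left ?_
      simp only [w]
      rw [hconj, RCLike.norm_conj, div_mul_div_comm, Complex.conj_mul', ← sq,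
        div_self (pow_ne_zero 2 (hn' r))]) fun a u v => by
        have h1 : ((‖φ (a + u + v)‖ : ℂ)) * ‖φ a‖ * ‖φ u‖ * ‖φ v‖ =
            ‖φ (a + u)‖ * ‖φ (a + v)‖ * ‖φ (u + v)‖ := by exact_mod_cast hnorm a u v
        simp only [w, div_mul_div_comm, hquad, h1])
  refine ⟨Q, ℓ, Matrix.PosSemidef.of_dotProduct_mulVec_nonneg ?_ fun r => ?_, fun r => ?_⟩
  · rw [Matrix.IsHermitian, Matrix.conjTranspose_eq_transpose_of_trivial]
    exact hQs
  · rw [star_trivial, ← hQ r]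
    have := Real.log_nonpos (norm_nonneg _) (hle r)
    linarith
  · rw [← hQ r, Complex.exp_add, ← hℓ r, ← Complex.ofReal_exp,
      show -(1 / 4) * (-4 * Real.log ‖φ r‖) = Real.log ‖φ r‖ by ring,
      Real.exp_log (norm_pos_iff.2 (hne r))]
    simp only [w]
    rw [mul_div_cancel₀ _ (hn' r)]

/-! ### Product states and Gaussian states -/

theorem charFn_rotation_eq {n : ℕ} {ρ σ₁ σ₂ : Modes n →L[ℂ] Modes n} (hρ : IsDensityOperator ρ)
    (h₁ : IsDensityOperator σ₁) (h₂ : IsDensityOperator σ₂) {θ : ℝ}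
    (h : rotConj θ (tensorOp ρ ρ) = tensorOp σ₁ σ₂) (r t : Phase n) :
    charFn ρ (Real.cos θ • r + Real.sin θ • t) * charFn ρ (-(Real.sin θ • r) + Real.cos θ • t) =
      charFn σ₁ r * charFn σ₂ t := by
  obtain ⟨_, _, -, hg, -⟩ := hρ.exists_isEnsemble
  obtain ⟨_, _, -, hg₁, -⟩ := h₁.exists_isEnsemble
  obtain ⟨_, _, -, hg₂, -⟩ := h₂.exists_isEnsemble
  rw [← hg₁.opTrace_twoDisplacement_tensorOp hg₂, ← hg.opTrace_twoDisplacement_tensorOp hg, ← h,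
    opTrace_twoDisplacement_rotConj (hg.tensor hg)]

/-- The hypothesis equates the characteristic functions of the two sides, and these determine the
operators. -/
theorem rotConj_tensorOp_eq {n : ℕ} {ρ σ₁ σ₂ : Modes n →L[ℂ] Modes n} (hρ : IsDensityOperator ρ)
    (h₁ : IsDensityOperator σ₁) (h₂ : IsDensityOperator σ₂) {θ : ℝ}
    (h : ∀ r t : Phase n, charFn ρ (Real.cos θ • r + Real.sin θ • t) *
      charFn ρ (-(Real.sin θ • r) + Real.cos θ • t) = charFn σ₁ r * charFn σ₂ t) :
    rotConj θ (tensorOp ρ ρ) = tensorOp σ₁ σ₂ := by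
  obtain ⟨_, _, _, hg, -⟩ := hρ.exists_isEnsemble
  obtain ⟨_, _, _, hg₁, -⟩ := h₁.exists_isEnsemble
  obtain ⟨_, _, _, hg₂, -⟩ := h₂.exists_isEnsemble
  refine ((hg.tensor hg).map (rotU n θ)).eq_of_opTrace_twoDisplacement (hg₁.tensor hg₂)
    fun r t => ?_
  rw [hg₁.opTrace_twoDisplacement_tensorOp hg₂, ← h, ← hg.opTrace_twoDisplacement_tensorOp hg]
  exact opTrace_twoDisplacement_rotConj (hg.tensor hg) θ r t

open Matrix

theorem Omega_transpose_mul_Omega (n : ℕ) : (Omega n)ᵀ * Omega n = 1 := by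
  simp [Omega, Matrix.fromBlocks_transpose, Matrix.fromBlocks_multiply]

theorem Omega_mul_Omega_transpose (n : ℕ) : Omega n * (Omega n)ᵀ = 1 := by
  simp [Omega, Matrix.fromBlocks_transpose, Matrix.fromBlocks_multiply]

/-- Links the matrix form of the Gaussian exponent to the phase in
`IsDensityOperator.charFn_conj_displacement`; the two have opposite signs. -/
theorem dotProduct_Omega_mulVec {n : ℕ} (r a : Phase n) : r ⬝ᵥ (Omega n *ᵥ a) =
    inner ℝ (momPart a) (posPart r) - inner ℝ (momPart r) (posPart a) := by
  have h : Omega n *ᵥ a = Sum.elim (fun j => a (Sum.inr j)) fun j => -a (Sum.inl j) := by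
    rw [Omega, Matrix.fromBlocks_mulVec]
    ext (j | j) <;> simp [Matrix.neg_mulVec]
  rw [h, dotProduct, Fintype.sum_sum_type]
  simp [PiLp.inner_apply, posPart, momPart, sub_eq_add_neg, mul_comm]

theorem isGaussian_of_isProductState {n : ℕ} {ρ : Modes n →L[ℂ] Modes n}
    (hρ : IsDensityOperator ρ) {θ : ℝ} (hθ : ∀ k : ℤ, θ ≠ k * (Real.pi / 2))
    (h : IsProductState (rotConj θ (tensorOp ρ ρ))) : IsGaussian ρ := by
  obtain ⟨σ₁, σ₂, h₁, h₂, h⟩ := h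
  have hs : Real.sin θ ≠ 0 := fun h0 => by
    obtain ⟨k, hk⟩ := Real.sin_eq_zero_iff.1 h0
    refine hθ (2 * k) ?_
    rw [← hk]
    push_cast
    ring
  have hc : Real.cos θ ≠ 0 := fun h0 => by
    obtain ⟨k, hk⟩ := Real.cos_eq_zero_iff.1 h0
    refine hθ (2 * k + 1) ?_
    rw [hk]
    push_cast
    ring
  obtain ⟨Q, ℓ, hQ, hφ⟩ := exists_gaussian_of_rotation_eq hρ.continuous_charFn hρ.charFn_zero
    hρ.norm_charFn_le hρ.charFn_neg (Real.cos_sq_add_sin_sq θ) hc hs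
    (charFn_rotation_eq hρ h₁ h₂ h)
  have hV : ∀ r : Phase n, (Omega n * Q * (Omega n)ᵀ) *ᵥ (Omega n *ᵥ r) =
      Omega n *ᵥ (Q *ᵥ r) := fun r => by
    rw [Matrix.mulVec_mulVec, Matrix.mul_assoc, Omega_transpose_mul_Omega, Matrix.mul_one,
      Matrix.mulVec_mulVec]
  -- Since `Omega n` is orthogonal, these undo the substitution of `Ω r` for `r` in the quadratic
  -- term and of `Ω m` for `ℓ` in the linear one.
  refine ⟨Omega n * Q * (Omega n)ᵀ, (Omega n)ᵀ *ᵥ ℓ, ?_, fun r => ?_⟩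
  · have := hQ.mul_mul_conjTranspose_same (Omega n)
    rwa [Matrix.conjTranspose_eq_transpose_of_trivial] at this
  · rw [hφ, hV, Matrix.mulVec_mulVec ℓ, Omega_mul_Omega_transpose, Matrix.one_mulVec,
      Matrix.dotProduct_mulVec (Omega n *ᵥ r), ← Matrix.mulVec_transpose, Matrix.mulVec_mulVec,
      Omega_transpose_mul_Omega, Matrix.one_mulVec]

theorem IsGaussian.isProductState {n : ℕ} {ρ : Modes n →L[ℂ] Modes n} (hG : IsGaussian ρ)
    (hρ : IsDensityOperator ρ) (θ : ℝ) : IsProductState (rotConj θ (tensorOp ρ ρ)) := by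
  obtain ⟨V, m, -, hφ⟩ := hG
  have hdisp : ∀ a : Phase n, IsDensityOperator
      (displacement a ∘L ρ ∘L ContinuousLinearMap.adjoint (displacement a)) := fun a =>
    hρ.conj ((modulation a).comp (translation (posPart a)))
  -- Rotation changes the means to `(cos θ - sin θ) m` and `(cos θ + sin θ) m`. Displacing `ρ` by
  -- `a` moves its mean from `m` to `m - a`, which dictates these two vectors.
  refine ⟨_, _, hdisp ((1 - Real.cos θ + Real.sin θ) • m),
    hdisp ((1 - Real.cos θ - Real.sin θ) • m), rotConj_tensorOp_eq hρ (hdisp _) (hdisp _)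
      fun r t => ?_⟩
  have h := Real.sin_sq_add_cos_sq θ
  simp only [hρ.charFn_conj_displacement, ← neg_sub (inner ℝ (momPart (_ • m)) _),
    ← dotProduct_Omega_mulVec, hφ, ← Complex.exp_add]
  congr 1
  simp only [Matrix.mulVec_add, Matrix.mulVec_neg, Matrix.mulVec_smul, dotProduct_add,
    add_dotProduct, dotProduct_neg, neg_dotProduct, dotProduct_smul, smul_dotProduct, smul_eq_mul]
  push_cast
  have h' : (Real.sin θ : ℂ) ^ 2 + (Real.cos θ : ℂ) ^ 2 = 1 := by exact_mod_cast h
  push_cast at h'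
  linear_combination (-(1 / 4) * (((Omega n *ᵥ r) ⬝ᵥ (V *ᵥ (Omega n *ᵥ r)) : ℝ) +
    ((Omega n *ᵥ t) ⬝ᵥ (V *ᵥ (Omega n *ᵥ t)) : ℝ) : ℂ)) * h'

end

end QuantumGaussian

theorem mainTheorem10 (n : ℕ) (ρ : QuantumGaussian.Modes n →L[ℂ] QuantumGaussian.Modes n)
    (hρ : QuantumGaussian.IsDensityOperator ρ)
    (hmom : QuantumGaussian.HasFiniteSecondMoments ρ) :
    List.TFAE [
      ∀ θ ∈ Set.Icc (0 : ℝ) (2 * Real.pi),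
        QuantumGaussian.IsProductState
          (QuantumGaussian.rotConj θ (QuantumGaussian.tensorOp ρ ρ)),
      ∃ θ : ℝ, (∀ k : ℤ, θ ≠ k * (Real.pi / 2)) ∧
        QuantumGaussian.IsProductState
          (QuantumGaussian.rotConj θ (QuantumGaussian.tensorOp ρ ρ)),
      QuantumGaussian.IsGaussian ρ] := by
  tfae_have 1 → 2 := fun h => by
    have hpi := Real.pi_pos
    -- The angle `π / 4` is not an integer multiple of `π / 2`, by parity.
    refine ⟨Real.pi / 4, fun k hk => ?_, h _ ⟨by positivity, by linarith⟩⟩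
    have h1 : (2 * k : ℝ) = 1 := mul_right_cancel₀ hpi.ne' (by linarith)
    have h2 : 2 * k = 1 := by exact_mod_cast h1
    omega
  tfae_have 2 → 3 := fun ⟨_, hθ, h⟩ => QuantumGaussian.isGaussian_of_isProductState hρ hθ h
  tfae_have 3 → 1 := fun h θ _ => h.isProductState hρ θ
  tfae_finish
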